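/- Let $X$ be a rank-one symmetric space of negative curvature other than the real hyperbolic plane, i.e. (up to rescaling the metric) $X$ is isometric to $\mathbb H^n_{\mathbb R}$ with $n\ge 3$, to $\mathbb H^n_{\mathbb C}$ or $\mathbb H^n_{\mathbb H}$ with $n\ge 2$, or to the octonionic hyperbolic plane $\mathbb H^2_{\mathbb O}$; let $d_X$ be its metric. A Busemann function on $X$ is a function of the form $b(x)=\lim_{s\to\infty}\bigl(d_X(x,\gamma(s))-s\bigr)$ for a geodesic ray $\gamma:[0,\infty)\to X$, and an open horoball is a set $\{x\in X: b(x)<t\}$ with $b$ a Busemann function and $t\in\mathbb R$. A truncated space is the complement in $X$ of a set of pairwise disjoint open horoballs. It is equivariant if it is invariant under some lattice $\Gamma\subset\mathrm{Isom}(X)$ (a discrete subgroup, uniform or not, such that $X/\Gamma$ has finite volume) for which $\Omega/\Gamma$ is compact. Let $\Omega\subset X$ be an equivariant truncated space, and for $x,y\in\Omega$ let $d_\Omega(x,y)$ be the infimum of the $d_X$-lengths of continuous paths from $x$ to $y$ inside $\Omega$. Then $d_\Omega(x,y)<\infty$ for all $x,y\in\Omega$, and the inclusion $(\Omega,d_\Omega)\hookrightarrow(X,d_X)$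 is a coarse embedding: there are non-decreasing functions $\alpha,\omega:[0,\infty)\to\mathbb R$ with $\alpha(t)\le\omega(t)$ for all $t\ge 0$ and $\lim_{t\to\infty}\alpha(t)=\infty$ such that for all $x,y\in\Omega$ $$\alpha\bigl(d_\Omega(x,y)\bigr)\le d_X(x,y)\le\omega\bigl(d_\Omega(x,y)\bigr).$$ -/

import Mathlib

open Set Filter Topology MeasureTheory
open scoped NNReal ENNReal Quaternion

noncomputable section

namespace RankOne

/-! ### The coordinate algebras ℝ, ℂ, ℍ and 𝕆

The class below only serves to treat the four algebras uniformly; it is instantiated at `ℝ`, `ℂ`,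
`ℍ[ℝ]` and the octonions, and the main theorem only uses these four instances. The real part of `a`
is `⟪1, a⟫`. -/

/-- A Euclidean unital composition algebra with conjugation. -/
class HurwitzAlgebra (K : Type) [NormedAddCommGroup K] [InnerProductSpace ℝ K] where
  /-- the unit -/
  one : K
  /-- the (possibly non-associative) multiplication -/
  mul : K →ₗ[ℝ] K →ₗ[ℝ] K
  /-- conjugation -/
  conj : K →ₗ[ℝ] K
  one_mul' : ∀ a, mul one a = a
  mul_one' : ∀ a, mul a one = a
  norm_one' : ‖one‖ = 1
  norm_mul' : ∀ a b, ‖mul a b‖ = ‖a‖ * ‖b‖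
  conj_eq : ∀ a, conj a = (2 * inner ℝ one a) • one - a
  conj_mul_self : ∀ a, mul (conj a) a = (‖a‖ ^ 2) • one
  conj_conj_mul : ∀ a b, conj (mul (conj a) b) = mul (conj b) a

instance : HurwitzAlgebra ℝ where
  one := 1
  mul := LinearMap.mul ℝ ℝ
  conj := LinearMap.id
  one_mul' a := by simp
  mul_one' a := by simp
  norm_one' := by simp
  norm_mul' a b := by simp
  conj_eq a := by simp; ring
  conj_mul_self a := by simp; ring
  conj_conj_mul a b := by simp; ring

instance : HurwitzAlgebra ℂ where
  one := 1
  mul := LinearMap.mul ℝ ℂ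
  conj := Complex.conjAe.toLinearMap
  one_mul' a := by simp
  mul_one' a := by simp
  norm_one' := by simp
  norm_mul' a b := by simp
  conj_eq a := by
    apply Complex.ext <;> simp [Complex.inner]
    ring
  conj_mul_self a := by
    simp [← Complex.normSq_eq_conj_mul_self, Complex.normSq_eq_norm_sq]
  conj_conj_mul a b := by simp; ring

instance : HurwitzAlgebra ℍ[ℝ] where
  one := 1
  mul := LinearMap.mul ℝ ℍ[ℝ]
  conj :=
    { toFun := star
      map_add' := star_add
      map_smul' := fun c x => Quaternion.star_smul c x }
  one_mul' a := by simp
  mul_one' a := by simp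
  norm_one' := by simp
  norm_mul' a b := by simp
  conj_eq a := by
    ext <;> simp [Quaternion.inner_def]
    ring
  conj_mul_self a := by
    simp only [LinearMap.mul_apply', LinearMap.coe_mk, AddHom.coe_mk]
    rw [Quaternion.star_mul_self, Quaternion.normSq_eq_norm_mul_self, sq]
    ext <;> simp
  conj_conj_mul a b := by simp

/-- The octonions, as pairs of quaternions with the Euclidean norm of `ℝ⁸`. -/
abbrev Octonion : Type := WithLp 2 (ℍ[ℝ] × ℍ[ℝ])

/-- The Cayley-Dickson product `(a, b) (c, d) = (a c - d̄ b, d a + b c̄)`. -/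
def Octonion.mul (x y : Octonion) : Octonion :=
  WithLp.toLp 2 (x.fst * y.fst - star y.snd * x.snd, y.snd * x.fst + x.snd * star y.fst)

/-- Octonionic conjugation `(a, b) ↦ (ā, -b)`. -/
def Octonion.conj (x : Octonion) : Octonion :=
  WithLp.toLp 2 (star x.fst, -x.snd)

theorem Octonion.ext' {x y : Octonion} (h1 : x.fst = y.fst) (h2 : x.snd = y.snd) : x = y := by
  apply (WithLp.equiv 2 _).injective
  exact Prod.ext h1 h2

theorem quaternion_norm_sq (a : ℍ[ℝ]) :
    ‖a‖ ^ 2 = a.re ^ 2 + a.imI ^ 2 + a.imJ ^ 2 + a.imK ^ 2 := by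
  rw [sq ‖a‖, ← Quaternion.normSq_eq_norm_mul_self, Quaternion.normSq_def']

instance : HurwitzAlgebra Octonion where
  one := WithLp.toLp 2 (1, 0)
  mul := LinearMap.mk₂ ℝ Octonion.mul
    (fun x y z => by
      apply Octonion.ext' <;> simp [Octonion.mul, add_mul, mul_add] <;> abel)
    (fun c x y => by
      apply Octonion.ext' <;> simp [Octonion.mul, smul_sub])
    (fun x y z => by
      apply Octonion.ext' <;> simp [Octonion.mul, add_mul, mul_add] <;> abel)
    (fun c x y => by
      apply Octonion.ext' <;> simp [Octonion.mul, smul_sub])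
  conj :=
    { toFun := Octonion.conj
      map_add' := fun x y => by
        apply Octonion.ext' <;> simp [Octonion.conj, add_comm]
      map_smul' := fun c x => by
        apply Octonion.ext' <;> simp [Octonion.conj] }
  one_mul' a := by apply Octonion.ext' <;> simp [Octonion.mul]
  mul_one' a := by apply Octonion.ext' <;> simp [Octonion.mul]
  norm_one' := by
    rw [← sq_eq_sq₀ (norm_nonneg _) zero_le_one, WithLp.prod_norm_sq_eq_of_L2]
    simp
  norm_mul' a b := by
    rw [← sq_eq_sq₀ (norm_nonneg _) (by positivity), mul_pow, WithLp.prod_norm_sq_eq_of_L2,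
      WithLp.prod_norm_sq_eq_of_L2 a, WithLp.prod_norm_sq_eq_of_L2 b]
    simp [Octonion.mul, quaternion_norm_sq]
    ring
  conj_eq a := by
    apply Octonion.ext'
    · ext <;> simp [Octonion.conj, Quaternion.inner_def]
      ring
    · simp [Octonion.conj]
  conj_mul_self a := by
    rw [WithLp.prod_norm_sq_eq_of_L2]
    apply Octonion.ext'
    · ext <;> simp [Octonion.conj, Octonion.mul, quaternion_norm_sq] <;> ring
    · simp [Octonion.conj, Octonion.mul]
  conj_conj_mul a b := by
    apply Octonion.ext' <;> simp [Octonion.conj, Octonion.mul]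

/-! ### The hyperbolic spaces -/

namespace HurwitzAlgebra

variable {K : Type} [NormedAddCommGroup K] [InnerProductSpace ℝ K] [HurwitzAlgebra K]

/-- The real part. -/
def re (a : K) : ℝ := inner ℝ (one : K) a

theorem re_add (a b : K) : re (a + b) = re a + re b := inner_add_right _ _ _

theorem re_sub (a b : K) : re (a - b) = re a - re b := inner_sub_right _ _ _

theorem re_smul (c : ℝ) (a : K) : re (c • a) = c * re a := inner_smul_right _ _ _

theorem re_one : re (one : K) = 1 := by
  simp [re, norm_one']

theorem conj_eq' (a : K) : conj a = (2 * re a) • one - a := conj_eq a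

theorem re_conj (a : K) : re (conj a) = re a := by
  rw [conj_eq', re_sub, re_smul, re_one]; ring

theorem conj_conj (a : K) : conj (conj a) = a := by
  rw [conj_eq' (conj a), re_conj, conj_eq']; abel

theorem conj_one : conj (one : K) = one := by
  rw [conj_eq', re_one]; module

theorem norm_conj (a : K) : ‖conj a‖ = ‖a‖ := by
  rw [← sq_eq_sq₀ (norm_nonneg _) (norm_nonneg _), conj_eq', norm_sub_sq_real, norm_smul,
    inner_smul_left, norm_one']
  have : inner ℝ (one : K) a = re a := rfl
  rw [this, Real.norm_eq_abs, mul_one, sq_abs]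
  simp only [conj_trivial]
  ring

theorem re_le_norm (a : K) : re a ≤ ‖a‖ := by
  have := real_inner_le_norm (one : K) a
  rwa [norm_one', one_mul] at this

theorem re_conj_mul (a b : K) : re (mul (conj a) b) = inner ℝ a b := by
  have h := conj_mul_self (a + b)
  simp only [map_add, LinearMap.add_apply, conj_mul_self, norm_add_sq_real] at h
  have h2 := congrArg re h
  simp only [re_add, re_smul, re_one, ← conj_conj_mul a b, re_conj] at h2
  linarith

/-- The standard `K`-valued Hermitian product `∑ x̄ᵢ yᵢ` on `Kᵐ`. -/
def sesq {m : ℕ} (x y : PiLp 2 (fun _ : Fin m => K)) : K := ∑ i, mul (conj (x i)) (y i)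

section
variable {m : ℕ} (x y z : PiLp 2 (fun _ : Fin m => K))

theorem sesq_sub_left : sesq (x - y) z = sesq x z - sesq y z := by
  simp [sesq, Finset.sum_sub_distrib]

theorem sesq_sub_right : sesq x (y - z) = sesq x y - sesq x z := by
  simp [sesq, Finset.sum_sub_distrib]

theorem conj_sesq : conj (sesq x y) = sesq y x := by
  simp [sesq, conj_conj_mul]

theorem sesq_self : sesq x x = (‖x‖ ^ 2) • one := by
  simp [sesq, conj_mul_self, PiLp.norm_sq_eq_of_L2, Finset.sum_smul]

theorem re_sesq : re (sesq x y) = inner ℝ x y := by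
  rw [PiLp.inner_apply]
  simp only [sesq, ← re_conj_mul]
  simp only [re, inner_sum]

theorem norm_sesq_le : ‖sesq x y‖ ≤ ‖x‖ * ‖y‖ := by
  calc ‖sesq x y‖ ≤ ∑ i, ‖x i‖ * ‖y i‖ := by
        refine (norm_sum_le _ _).trans (le_of_eq ?_)
        simp [norm_mul', norm_conj]
    _ ≤ √(∑ i, ‖x i‖ ^ 2) * √(∑ i, ‖y i‖ ^ 2) := Real.sum_mul_le_sqrt_mul_sqrt _ _ _
    _ = ‖x‖ * ‖y‖ := by rw [PiLp.norm_eq_of_L2, PiLp.norm_eq_of_L2]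

end

end HurwitzAlgebra

open HurwitzAlgebra

/-- Hyperbolic `n`-space over `K` (`n ≥ 1`) in the Siegel domain model
`{(x, a) ∈ Kⁿ⁻¹ × K : |x|² < Re a}`; the point `(x, a)` has horospherical
coordinates `((x, Im a), Re a - |x|²)`. For `K = ℝ` this is the upper half-space model, with height
the square root of `Re a - |x|²`. -/
@[ext]
structure HypSpace (K : Type) [NormedAddCommGroup K] [InnerProductSpace ℝ K] [HurwitzAlgebra K]
    (n : ℕ) where
  /-- the coordinate in `Kⁿ⁻¹` -/
  vec : PiLp 2 (fun _ : Fin (n - 1) => K)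
  /-- the last coordinate -/
  last : K
  norm_sq_lt : ‖vec‖ ^ 2 < re last

namespace HypSpace

variable {K : Type} [NormedAddCommGroup K] [InnerProductSpace ℝ K] [HurwitzAlgebra K] {n : ℕ}

/-- The Hermitian product `⟨(x, a), (y, b)⟩ = ā + b - 2 ∑ x̄ᵢ yᵢ` of signature `(n, 1)` up to sign,
in the affine chart. -/
def herm (p q : HypSpace K n) : K := conj p.last + q.last - (2 : ℝ) • sesq p.vec q.vec

/-- `⟨p, p⟩ / 2`. -/
def height (p : HypSpace K n) : ℝ := re p.last - ‖p.vec‖ ^ 2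

theorem height_pos (p : HypSpace K n) : 0 < p.height := sub_pos.2 p.norm_sq_lt

theorem herm_self (p : HypSpace K n) : herm p p = (2 * p.height) • one := by
  rw [herm, height, sesq_self, conj_eq']
  module

theorem norm_herm_comm (p q : HypSpace K n) : ‖herm p q‖ = ‖herm q p‖ := by
  rw [← norm_conj (herm p q)]
  congr 1
  simp only [herm, map_sub, map_add, map_smul, conj_sesq, conj_conj]
  abel

theorem re_herm (p q : HypSpace K n) :
    re (herm p q) = p.height + q.height + ‖p.vec - q.vec‖ ^ 2 := by
  rw [herm, re_sub, re_add, re_conj, re_smul, re_sesq, norm_sub_sq_real, height, height]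
  ring

theorem two_sqrt_le (p q : HypSpace K n) : 2 * √(p.height * q.height) ≤ ‖herm p q‖ := by
  refine le_trans ?_ (re_le_norm _)
  rw [re_herm, Real.sqrt_mul p.height_pos.le]
  nlinarith [sq_nonneg (√p.height - √q.height), Real.sq_sqrt p.height_pos.le,
    Real.sq_sqrt q.height_pos.le, sq_nonneg ‖p.vec - q.vec‖]

/-- `cosh d(p, q) = |⟨p, q⟩| / √(⟨p, p⟩ ⟨q, q⟩)`. -/
def coshDist (p q : HypSpace K n) : ℝ := ‖herm p q‖ / (2 * √(p.height * q.height))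

theorem one_le_coshDist (p q : HypSpace K n) : 1 ≤ coshDist p q := by
  have : 0 < √(p.height * q.height) := Real.sqrt_pos.2 (mul_pos p.height_pos q.height_pos)
  rw [coshDist, one_le_div (by positivity)]
  exact two_sqrt_le p q

theorem coshDist_sq (p q : HypSpace K n) :
    coshDist p q ^ 2 = ‖herm p q‖ ^ 2 / (4 * (p.height * q.height)) := by
  rw [coshDist, div_pow, mul_pow, Real.sq_sqrt (mul_pos p.height_pos q.height_pos).le]
  norm_num

/-- The triangle inequality at a point with coordinates `(0, c)`. -/
theorem core {m : ℕ} (x y : PiLp 2 (fun _ : Fin m => K)) (a b : K) {c : ℝ} (hc : 0 < c) :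
    2 * c * ‖conj a + b - (2 : ℝ) • sesq x y‖ ≤
      ‖a + c • one‖ * ‖b + c • one‖ + √(‖a + c • one‖ ^ 2 - 4 * c * (re a - ‖x‖ ^ 2)) *
        √(‖b + c • one‖ ^ 2 - 4 * c * (re b - ‖y‖ ^ 2)) := by
  have key (a : K) (x : PiLp 2 (fun _ : Fin m => K)) :
      ‖a + c • one‖ ^ 2 - 4 * c * (re a - ‖x‖ ^ 2) = ‖a - c • one‖ ^ 2 + 4 * c * ‖x‖ ^ 2 := by
    rw [norm_add_sq_real, norm_sub_sq_real, inner_smul_right, real_inner_comm]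
    have : inner ℝ (one : K) a = re a := rfl
    rw [this]; ring
  have hco (a : K) (c : ℝ) : ‖conj a + c • one‖ = ‖a + c • one‖ := by
    rw [← norm_conj (a + c • one), map_add, map_smul, conj_one]
  have hco' : ‖conj a - c • one‖ = ‖a - c • one‖ := by
    rw [← norm_conj (a - c • one), map_sub, map_smul, conj_one]
  rw [key, key]
  have h1 : (2 * c) • (conj a + b - (2 : ℝ) • sesq x y) =
      mul (conj a + c • one) (b + c • one) - mul (conj a - c • one) (b - c • one)
        - (4 * c) • sesq x y := by
    simp only [map_add, map_sub, LinearMap.add_apply, LinearMap.sub_apply, map_smul,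
      LinearMap.smul_apply, one_mul', mul_one']
    module
  have h2 : 2 * c * ‖conj a + b - (2 : ℝ) • sesq x y‖ ≤
      ‖a + c • one‖ * ‖b + c • one‖ + ‖a - c • one‖ * ‖b - c • one‖ + 4 * c * (‖x‖ * ‖y‖) := by
    have : 2 * c * ‖conj a + b - (2 : ℝ) • sesq x y‖ =
        ‖(2 * c) • (conj a + b - (2 : ℝ) • sesq x y)‖ := by
      rw [norm_smul, Real.norm_of_nonneg (by positivity)]
    rw [this, h1]
    refine (norm_sub_le _ _).trans (add_le_add ((norm_sub_le _ _).trans ?_) ?_)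
    · rw [norm_mul', norm_mul', hco, hco']
    · rw [norm_smul, Real.norm_of_nonneg (by positivity)]
      exact mul_le_mul_of_nonneg_left (norm_sesq_le x y) (by positivity)
  refine h2.trans ?_
  rw [add_assoc, add_le_add_iff_left, ← Real.sqrt_mul (by positivity)]
  apply Real.le_sqrt_of_sq_le
  nlinarith [mul_nonneg hc.le (sq_nonneg (‖a - c • one‖ * ‖y‖ - ‖b - c • one‖ * ‖x‖))]

theorem herm_triangle (p r q : HypSpace K n) :
    2 * r.height * ‖herm p q‖ ≤ ‖herm p r‖ * ‖herm r q‖ +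
      √(‖herm p r‖ ^ 2 - 4 * (r.height * p.height)) *
        √(‖herm r q‖ ^ 2 - 4 * (r.height * q.height)) := by
  -- translate `r` to `(0, height r)` by an element of the generalized Heisenberg group
  let T (s : HypSpace K n) : K :=
    s.last + (re r.last + ‖r.vec‖ ^ 2) • one - r.last - (2 : ℝ) • sesq r.vec s.vec
  have hT (s : HypSpace K n) : herm r s = T s + r.height • one := by
    simp only [herm, T, height, conj_eq' r.last]
    module
  have hre (s : HypSpace K n) : re (T s) - ‖s.vec - r.vec‖ ^ 2 = s.height := by
    simp only [T, height, re_sub, re_add, re_smul, re_one, re_sesq, norm_sub_sq_real,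
      real_inner_comm s.vec r.vec]
    ring
  have hpq : herm p q = conj (T p) + T q - (2 : ℝ) • sesq (p.vec - r.vec) (q.vec - r.vec) := by
    simp only [herm, T, map_sub, map_add, map_smul, conj_one, conj_sesq, sesq_sub_left,
      sesq_sub_right, sesq_self, conj_eq' r.last]
    module
  have := core (p.vec - r.vec) (q.vec - r.vec) (T p) (T q) r.height_pos
  rw [hre, hre, ← hT, ← hT, ← hpq] at this
  rw [norm_herm_comm p r]
  simpa only [mul_assoc] using this

instance : MetricSpace (HypSpace K n) where
  dist p q := Real.arcosh (coshDist p q)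
  dist_self p := by
    have hp := p.height_pos
    have : coshDist p p = 1 := by
      rw [coshDist, herm_self, norm_smul, HurwitzAlgebra.norm_one', Real.sqrt_mul_self hp.le,
        Real.norm_of_nonneg (by positivity), mul_one, div_self (by positivity)]
    rw [this, Real.arcosh_zero]
  dist_comm p q := by
    rw [coshDist, coshDist, norm_herm_comm, mul_comm p.height]
  dist_triangle p r q := by
    have h1 := one_le_coshDist p r
    have h2 := one_le_coshDist r q
    have hs := Real.arcosh_nonneg h1
    have ht := Real.arcosh_nonneg h2
    have hp := Real.sqrt_pos.2 p.height_pos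
    have hq := Real.sqrt_pos.2 q.height_pos
    have hr := Real.sqrt_pos.2 r.height_pos
    change Real.arcosh (coshDist p q) ≤ Real.arcosh (coshDist p r) + Real.arcosh (coshDist r q)
    rw [← Real.arcosh_cosh (add_nonneg hs ht), Real.arcosh_le_arcosh
      (zero_lt_one.trans_le (one_le_coshDist p q)) (Real.cosh_pos _), Real.cosh_add,
      Real.cosh_arcosh h1, Real.cosh_arcosh h2, Real.sinh_arcosh h1, Real.sinh_arcosh h2]
    have e (N : ℝ) {h k : ℝ} (hh : 0 < h) (hk : 0 < k) :
        √(N ^ 2 / (4 * (h * k)) - 1) = √(N ^ 2 - 4 * (h * k)) / (2 * (√h * √k)) := by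
      rw [← Real.sqrt_mul hh.le, show (2 : ℝ) * √(h * k) = √(4 * (h * k)) by
        rw [Real.sqrt_mul (by norm_num : (0 : ℝ) ≤ 4), show (4 : ℝ) = 2 ^ 2 by norm_num,
          Real.sqrt_sq (by norm_num)], ← Real.sqrt_div' _ (by positivity), sub_div,
        div_self (by positivity)]
    rw [coshDist_sq, coshDist_sq, e _ p.height_pos r.height_pos, e _ r.height_pos q.height_pos]
    have H := herm_triangle p r q
    rw [mul_comm r.height p.height] at H
    simp only [coshDist, Real.sqrt_mul p.height_pos.le, Real.sqrt_mul r.height_pos.le]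
    rw [div_mul_div_comm, div_mul_div_comm, ← add_div, div_le_div_iff₀ (by positivity)
      (by positivity)]
    have hr2 := Real.sq_sqrt r.height_pos.le
    calc ‖herm p q‖ * (2 * (√p.height * √r.height) * (2 * (√r.height * √q.height)))
        = (2 * (√r.height) ^ 2 * ‖herm p q‖) * (2 * (√p.height * √q.height)) := by ring
      _ ≤ _ := by
        rw [hr2]
        exact mul_le_mul_of_nonneg_right H (by positivity)
  eq_of_dist_eq_zero {p q} h := by
    have h : Real.arcosh (coshDist p q) = 0 := h
    have hp := p.height_pos
    have hq := q.height_pos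
    rw [Real.arcosh_eq_zero_iff (one_le_coshDist p q), coshDist, div_eq_one_iff_eq
      (by have := Real.sqrt_pos.2 (mul_pos hp hq); positivity), Real.sqrt_mul hp.le] at h
    have h1 := re_le_norm (herm p q)
    rw [re_herm, h] at h1
    have hv : ‖p.vec - q.vec‖ ^ 2 = 0 := by
      nlinarith [sq_nonneg (√p.height - √q.height), Real.sq_sqrt hp.le,
        Real.sq_sqrt hq.le, sq_nonneg ‖p.vec - q.vec‖]
    have hh : (√p.height - √q.height) ^ 2 = 0 := by
      nlinarith [sq_nonneg (√p.height - √q.height), Real.sq_sqrt hp.le,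
        Real.sq_sqrt hq.le, sq_nonneg ‖p.vec - q.vec‖]
    have hvec : p.vec = q.vec := by
      rwa [sq_eq_zero_iff, norm_eq_zero, sub_eq_zero] at hv
    rw [sq_eq_zero_iff, sub_eq_zero, Real.sqrt_inj hp.le hq.le] at hh
    have hre : re (q.last - p.last) = 0 := by
      have := hh
      rw [height, height, hvec] at this
      rw [re_sub]; linarith
    have hherm : herm p q = (2 * p.height) • one + (q.last - p.last) := by
      rw [herm, height, ← hvec, sesq_self, conj_eq']
      module
    have h2 : ‖herm p q‖ ^ 2 = (2 * p.height) ^ 2 := by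
      rw [h, ← hh, Real.mul_self_sqrt hp.le]
    rw [hherm, norm_add_sq_real, norm_smul, HurwitzAlgebra.norm_one', inner_smul_left] at h2
    change _ + 2 * (_ * re (q.last - p.last)) + _ = _ at h2
    rw [hre, mul_one, Real.norm_eq_abs, sq_abs] at h2
    have h3 : ‖q.last - p.last‖ ^ 2 = 0 := by linarith
    rw [sq_eq_zero_iff, norm_eq_zero, sub_eq_zero] at h3
    exact HypSpace.ext hvec h3.symm

theorem cosh_dist (p q : HypSpace K n) :
    Real.cosh (dist p q) = ‖herm p q‖ / (2 * √(p.height * q.height)) :=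
  Real.cosh_arcosh (one_le_coshDist p q)

end HypSpace

/-- `X` is, up to a rescaling of its metric, one of the rank-one symmetric spaces of negative
curvature other than the real hyperbolic plane: real hyperbolic space of dimension at least `3`,
complex or quaternionic hyperbolic space of dimension at least `2` over `ℂ` or `ℍ`, or the
octonionic hyperbolic plane. (`X ≃ᵈ Y` is the type of bijective similarities. The quaternionic
hyperbolic line is similar to real hyperbolic `4`-space, the complex one to the real plane.) -/
def IsRankOneSymmetricSpace (X : Type*) [MetricSpace X] : Prop :=
  (∃ n : ℕ, 3 ≤ n ∧ Nonempty (X ≃ᵈ HypSpace ℝ n)) ∨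
  (∃ n : ℕ, 2 ≤ n ∧ Nonempty (X ≃ᵈ HypSpace ℂ n)) ∨
  (∃ n : ℕ, 2 ≤ n ∧ Nonempty (X ≃ᵈ HypSpace ℍ[ℝ] n)) ∨
  Nonempty (X ≃ᵈ HypSpace Octonion 2)

/-! ### Horoballs and truncated spaces -/

section

variable {X : Type*} [MetricSpace X]

/-- `b(x) = lim_{s → ∞} (d(x, γ(s)) - s)` for some geodesic ray `γ`. -/
def IsBusemannFunction (b : X → ℝ) : Prop :=
  ∃ γ : ℝ≥0 → X, Isometry γ ∧
    ∀ x, Tendsto (fun s : ℝ≥0 => dist x (γ s) - (s : ℝ)) atTop (𝓝 (b x))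

/-- An open horoball: a strict sublevel set of a Busemann function. -/
def IsOpenHoroball (B : Set X) : Prop :=
  ∃ (b : X → ℝ) (t : ℝ), IsBusemannFunction b ∧ B = {x | b x < t}

/-- A truncated space: the complement of a set of pairwise disjoint open horoballs. -/
def IsTruncatedSpace (Ω : Set X) : Prop :=
  ∃ 𝓑 : Set (Set X), (∀ B ∈ 𝓑, IsOpenHoroball B) ∧ 𝓑.PairwiseDisjoint id ∧ Ω = (⋃₀ 𝓑)ᶜ

/-- The tautological action of `Isom(X)` on `X`. -/
instance : MulAction (X ≃ᵢ X) X where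
  smul g x := g x
  one_smul _ := rfl
  mul_smul _ _ _ := rfl

/-- The compact-open topology on `Isom(X)`. -/
instance : TopologicalSpace (X ≃ᵢ X) :=
  TopologicalSpace.induced (fun g => (⟨g, g.continuous⟩ : C(X, X))) inferInstance

/-- Riemannian volume up to a constant factor: the Hausdorff measure in the dimension of `X`. -/
def vol (X : Type*) [MetricSpace X] [MeasurableSpace X] [BorelSpace X] : Measure X :=
  Measure.hausdorffMeasure (dimH (Set.univ : Set X)).toReal

/-- A lattice: a discrete group of isometries such that `X / Γ` has finite volume. -/
def IsLattice [MeasurableSpace X] [BorelSpace X] (Γ : Subgroup (X ≃ᵢ X)) : Prop :=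
  DiscreteTopology Γ ∧ ∃ F : Set X, IsFundamentalDomain Γ F (vol X) ∧ vol X F < ∞

/-- An equivariant truncated space: some lattice `Γ` leaves `Ω` invariant and `Ω / Γ`, regarded as
a subset of `X / Γ`, is compact. -/
def IsEquivariantTruncatedSpace [MeasurableSpace X] [BorelSpace X] (Ω : Set X) : Prop :=
  IsTruncatedSpace Ω ∧ ∃ Γ : Subgroup (X ≃ᵢ X), IsLattice Γ ∧ (∀ g ∈ Γ, g '' Ω = Ω) ∧
    IsCompact ((Quotient.mk (MulAction.orbitRel Γ X)) '' Ω)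

end

/-! ### Path metrics and coarse embeddings -/

/-- The induced path metric: the infimum of the lengths of the continuous paths in `Y` from `x` to
`y` (and `∞` if there is no rectifiable path). -/
def pathEDist {Y : Type*} [PseudoEMetricSpace Y] (x y : Y) : ℝ≥0∞ :=
  ⨅ γ : Path x y, eVariationOn γ Set.univ

/-- `f` is a coarse embedding for the distance functions `dA` and `dB`. -/
def IsCoarseEmbedding {A B : Type*} (dA : A → A → ℝ≥0) (dB : B → B → ℝ≥0) (f : A → B) : Prop :=
  ∃ α ω : ℝ≥0 → ℝ, Monotone α ∧ Monotone ω ∧ (∀ t, α t ≤ ω t) ∧ Tendsto α atTop atTop ∧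
    ∀ x x' : A, α (dA x x') ≤ dB (f x) (f x') ∧ (dB (f x) (f x') : ℝ) ≤ ω (dA x x')

end RankOne

end

/-! Paths in `Ω` are paths in `X`, so `d_X ≤ d_Ω` and `ω` can be the identity. For `α` it suffices
that for each `R` some `M` bounds `d_Ω(x, y)` whenever `d_X(x, y) ≤ R`
(`isCoarseEmbedding_of_joinedByCurve`).

Such points are joined in `X` by a curve of length at most `G R`, which stays in the ball of radius
`G R` about `x`. Every removed horoball meeting this ball contains a unit ball close to it. These
unit balls are disjoint, so homogeneity and total boundedness of balls bound their number `N` in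
terms of `R` alone. Each horoball in turn is avoided by replacing the part of the curve between its
first and last visit to the horosphere by a curve in the horosphere (`JoinedByCurve.detour`). Since
points of a horosphere at distance `d` are joined in it by a curve of length at most `sinh d`, one
detour turns length `L` into at most `L + sinh L`. The other horoballs are disjoint from this one
and open, so the detour does not enter them. After `N` detours the length is still bounded in terms
of `R` (`exists_joinedByCurve_compl`).

The geometry is computed in the Siegel model. Horoballs about `∞` are described by the height alone,
and an orbit of a one-parameter group of Heisenberg translations joins two points of a horosphere.
Every other Busemann function reduces to the one of `∞` by a translation followed by an inversion
(`exists_isometryEquiv_of_tendsto`). That the inversion is an isometry uses only composition algebra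
identities and `SesqNormMul`, which holds over `ℝ`, `ℂ`, `ℍ` by associativity and for the octonionic
plane because there is just one vector coordinate. -/

namespace RankOne

/-! ### Curves parametrized with speed at most one -/

section Curves

variable {Y : Type*} [MetricSpace Y]

/-- There is a curve `[0, L] → S` of speed at most one from `x` to `y`. -/
def JoinedByCurve (S : Set Y) (L : ℝ) (x y : Y) : Prop :=
  ∃ γ : ℝ → Y, γ 0 = x ∧ γ L = y ∧ 0 ≤ L ∧ (∀ s ∈ Icc 0 L, γ s ∈ S) ∧
    ∀ s ∈ Icc 0 L, ∀ t ∈ Icc 0 L, dist (γ s) (γ t) ≤ |s - t|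

theorem JoinedByCurve.refl {S : Set Y} {x : Y} (hx : x ∈ S) : JoinedByCurve S 0 x x :=
  ⟨fun _ => x, rfl, rfl, le_rfl, fun _ _ => hx, fun _ _ _ _ => by simp⟩

theorem JoinedByCurve.mono {S T : Set Y} {L M : ℝ} {x y : Y} (h : JoinedByCurve S L x y)
    (hST : S ⊆ T) (hLM : L ≤ M) : JoinedByCurve T M x y := by
  obtain ⟨γ, h0, h1, hL, hS, hd⟩ := h
  have hm : ∀ s ∈ Icc 0 M, min s L ∈ Icc 0 L := fun s hs => ⟨le_min hs.1 hL, min_le_right _ _⟩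
  -- The curve waits at its endpoint after time `L`.
  refine ⟨fun s => γ (min s L), by simp [hL, h0], by simp [hLM, h1], hL.trans hLM,
    fun s hs => hST (hS _ (hm s hs)), fun s hs t ht => (hd _ (hm s hs) _ (hm t ht)).trans ?_⟩
  exact (abs_min_sub_min_le_max s L t L).trans (by simp)

theorem JoinedByCurve.trans {S : Set Y} {L M : ℝ} {x y z : Y} (h : JoinedByCurve S L x y)
    (h' : JoinedByCurve S M y z) : JoinedByCurve S (L + M) x z := by
  obtain ⟨γ, h0, h1, hL, hS, hd⟩ := h
  obtain ⟨δ, k0, k1, hM, kS, kd⟩ := h'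
  have cross : ∀ s ∈ Icc 0 (L + M), ∀ t ∈ Icc 0 (L + M), s ≤ L → L < t →
      dist (γ s) (δ (t - L)) ≤ |s - t| := by
    intro s hs t ht hsL htL
    have e1 := hd s ⟨hs.1, hsL⟩ L ⟨hL, le_rfl⟩
    have e2 := kd 0 ⟨le_rfl, hM⟩ (t - L) ⟨by linarith, by linarith [ht.2]⟩
    rw [h1] at e1
    rw [k0] at e2
    rw [abs_of_nonpos (by linarith)] at e1 e2 ⊢
    linarith [dist_triangle (γ s) y (δ (t - L))]
  refine ⟨fun s => if s ≤ L then γ s else δ (s - L), by simp [hL, h0], ?_, by linarith, ?_, ?_⟩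
  · by_cases hM0 : M = 0
    · subst hM0
      simp [h1, ← k0, k1]
    · have : ¬ L + M ≤ L := by
        have := lt_of_le_of_ne hM (Ne.symm hM0)
        linarith
      simp [this, k1]
  · intro s hs
    dsimp only
    split_ifs with hsL
    · exact hS s ⟨hs.1, hsL⟩
    · exact kS _ ⟨by linarith, by linarith [hs.2]⟩
  · intro s hs t ht
    dsimp only
    split_ifs with hsL htL htL
    · exact hd s ⟨hs.1, hsL⟩ t ⟨ht.1, htL⟩
    · exact cross s hs t ht hsL (not_le.1 htL)
    · rw [dist_comm, abs_sub_comm]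
      exact cross t ht s hs htL (not_le.1 hsL)
    · refine (kd _ ⟨by linarith, by linarith [hs.2]⟩ _ ⟨by linarith, by linarith [ht.2]⟩).trans ?_
      simp

/-- The image of a curve under a map that scales distances. -/
theorem JoinedByCurve.map {Z : Type*} [MetricSpace Z] {S : Set Y} {T : Set Z} {L : ℝ} {x y : Y}
    (h : JoinedByCurve S L x y) (f : Y → Z) {r : ℝ} (hr : 0 < r)
    (hf : ∀ p q, dist (f p) (f q) = r * dist p q) (hST : MapsTo f S T) :
    JoinedByCurve T (r * L) (f x) (f y) := by
  obtain ⟨γ, h0, h1, hL, hS, hd⟩ := h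
  have hm : ∀ s ∈ Icc 0 (r * L), s / r ∈ Icc 0 L := fun s hs =>
    ⟨div_nonneg hs.1 hr.le, (div_le_iff₀' hr).2 hs.2⟩
  refine ⟨fun s => f (γ (s / r)), by simp [h0], by simp [hr.ne', h1], by positivity,
    fun s hs => hST (hS _ (hm s hs)), fun s hs t ht => ?_⟩
  rw [hf]
  refine (mul_le_mul_of_nonneg_left (hd _ (hm s hs) _ (hm t ht)) hr.le).trans (le_of_eq ?_)
  rw [← sub_div, abs_div, abs_of_pos hr]
  field_simp

theorem joinedByCurve_of_lipschitz {S : Set Y} {M : ℝ} {γ : ℝ → Y}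
    (hM : 0 ≤ M) (hS : ∀ s ∈ Icc (0 : ℝ) 1, γ s ∈ S)
    (hd : ∀ s ∈ Icc (0 : ℝ) 1, ∀ t ∈ Icc (0 : ℝ) 1, dist (γ s) (γ t) ≤ M * |s - t|) :
    JoinedByCurve S M (γ 0) (γ 1) := by
  -- The rescaling `s / M` below needs `M ≠ 0`; for `M = 0` the endpoints coincide.
  rcases hM.eq_or_lt with rfl | hM
  · have h := hd 0 (by simp) 1 (by simp)
    rw [zero_mul] at h
    rw [← dist_le_zero.1 h]
    exact .refl (hS 0 (by simp))
  have hm : ∀ s ∈ Icc 0 M, s / M ∈ Icc (0 : ℝ) 1 := fun s hs =>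
    ⟨div_nonneg hs.1 hM.le, (div_le_one hM).2 hs.2⟩
  refine ⟨fun s => γ (s / M), by simp, by simp [hM.ne'], hM.le, fun s hs => hS _ (hm s hs),
    fun s hs t ht => (hd _ (hm s hs) _ (hm t ht)).trans (le_of_eq ?_)⟩
  rw [← sub_div, abs_div, abs_of_pos hM]
  field_simp

theorem JoinedByCurve.pathEDist_le {S : Set Y} {L : ℝ} {x y : S}
    (h : JoinedByCurve S L (x : Y) y) : pathEDist x y ≤ ENNReal.ofReal L := by
  obtain ⟨γ, h0, h1, hL, hS, hd⟩ := h
  have hm : ∀ s : unitInterval, L * s ∈ Icc 0 L := fun s =>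
    ⟨mul_nonneg hL s.2.1, mul_le_of_le_one_right hL s.2.2⟩
  have hlip : LipschitzOnWith 1 γ (Icc 0 L) := LipschitzOnWith.of_dist_le_mul fun s hs t ht => by
    simpa [Real.dist_eq] using hd s hs t ht
  have hc : Continuous fun s : unitInterval => γ (L * s) :=
    hlip.continuousOn.comp_continuous (by fun_prop) hm
  let p : Path x y :=
    { toFun := fun s => ⟨γ (L * s), hS _ (hm s)⟩
      continuous_toFun := hc.subtype_mk _
      source' := Subtype.ext (by simp [h0])
      target' := Subtype.ext (by simp [h1]) }
  refine (iInf_le _ p).trans ?_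
  have e1 : eVariationOn (γ ∘ fun s : unitInterval => L * (s : ℝ)) univ ≤
      (1 : ℝ≥0) * eVariationOn (fun s : unitInterval => L * (s : ℝ)) univ :=
    hlip.comp_eVariationOn_le fun s _ => hm s
  have e2 : eVariationOn (fun s : unitInterval => L * (s : ℝ)) (univ ∩ Icc 0 1) =
      ENNReal.ofReal (L * ((1 : unitInterval) : ℝ) - L * ((0 : unitInterval) : ℝ)) :=
    MonotoneOn.eVariationOn_eq
      (fun s _ t _ hst => mul_le_mul_of_nonneg_left (Subtype.coe_le_coe.2 hst) hL)
      (mem_univ _) (mem_univ _)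
  have e3 : (univ : Set unitInterval) ∩ Icc 0 1 = univ := by
    exact Set.eq_univ_of_forall fun s => ⟨trivial, s.2⟩
  rw [e3] at e2
  refine (show eVariationOn p univ ≤ _ from e1).trans ?_
  simpa using e2.le

theorem edist_le_pathEDist (x y : Y) : edist x y ≤ pathEDist x y :=
  le_iInf fun γ => by
    simpa using eVariationOn.edist_le γ (mem_univ (0 : unitInterval)) (mem_univ 1)

end Curves

/-! ### Detours around horoballs -/

section Detours

variable {Y : Type*} [MetricSpace Y]

/-- The properties of an open horoball that the construction of short curves in its complement
uses: it is a strict sublevel set of a Lipschitz function which decreases at unit speed along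
suitable curves and whose level set is connected by curves of controlled length. -/
def IsDetourable (B : Set Y) : Prop :=
  ∃ (b : Y → ℝ) (t : ℝ), B = {x | b x < t} ∧ (∀ x y, b x ≤ b y + dist x y) ∧
    (∀ x, ∀ s : ℝ, 0 ≤ s → ∃ y, dist x y ≤ s ∧ b y = b x - s) ∧
    ∀ x y, b x = t → b y = t → JoinedByCurve {z | b z = t} (Real.sinh (dist x y)) x y

theorem continuous_of_le_add_dist {b : Y → ℝ} (hb : ∀ x y, b x ≤ b y + dist x y) :
    Continuous b := by
  refine (LipschitzWith.of_dist_le_mul (K := 1) fun x y => ?_).continuous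
  rw [Real.dist_eq, abs_le, NNReal.coe_one, one_mul]
  constructor
  · linarith [hb y x, dist_comm x y]
  · linarith [hb x y]

theorem IsDetourable.isOpen {B : Set Y} (h : IsDetourable B) : IsOpen B := by
  obtain ⟨b, t, rfl, hb, -⟩ := h
  exact isOpen_lt (continuous_of_le_add_dist hb) continuous_const

/-- A horoball that meets a ball contains a unit ball nearby. -/
theorem IsDetourable.exists_ball_subset {B : Set Y} (h : IsDetourable B) {x : Y} (hx : x ∈ B) :
    ∃ y, dist x y ≤ 1 ∧ Metric.ball y 1 ⊆ B := by
  obtain ⟨b, t, rfl, hb, hs, -⟩ := h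
  obtain ⟨y, hy, hby⟩ := hs x 1 zero_le_one
  refine ⟨y, hy, fun z hz => ?_⟩
  have := hb z y
  rw [Metric.mem_ball] at hz
  exact (show b z < t by linarith [show b x < t from hx])

/-- The length bound for a curve after one detour. -/
noncomputable def detourLength (L : ℝ) : ℝ := L + Real.sinh L

theorem le_detourLength {L : ℝ} (hL : 0 ≤ L) : L ≤ detourLength L := by
  have := Real.sinh_nonneg_iff.2 hL
  rw [detourLength]; linarith

theorem le_iterate_detourLength {L : ℝ} (hL : 0 ≤ L) (n : ℕ) : L ≤ detourLength^[n] L := by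
  induction n with
  | zero => exact le_rfl
  | succ k ih =>
    rw [Function.iterate_succ_apply']
    exact ih.trans (le_detourLength (hL.trans ih))

theorem iterate_detourLength_mono {L : ℝ} (hL : 0 ≤ L) {m n : ℕ} (h : m ≤ n) :
    detourLength^[m] L ≤ detourLength^[n] L := by
  obtain ⟨k, rfl⟩ := Nat.exists_eq_add_of_le h
  rw [add_comm, Function.iterate_add_apply]
  exact le_iterate_detourLength (hL.trans (le_iterate_detourLength hL m)) k

/-- A curve can be rerouted around a horoball along its boundary. -/
theorem JoinedByCurve.detour {S B : Set Y} {L : ℝ} {x y : Y} (h : JoinedByCurve (S ∪ B) L x y)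
    (hB : IsDetourable B) (hS : ∀ z ∈ frontier B, z ∈ S) (hx : x ∉ B) (hy : y ∉ B) :
    JoinedByCurve S (detourLength L) x y := by
  obtain ⟨b, t, rfl, hb, hs, hcon⟩ := hB
  obtain ⟨γ, h0, h1, hL, hγS, hd⟩ := h
  -- The level set lies in the frontier: descending at unit speed reaches `B` within any `ε`.
  have hlevel : ∀ z, b z = t → z ∈ S := fun z hz => by
    refine hS z ⟨?_, ?_⟩
    · refine Metric.mem_closure_iff.2 fun ε hε => ?_
      obtain ⟨w, hw, hbw⟩ := hs z (ε / 2) (by positivity)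
      exact ⟨w, show b w < t by linarith, by linarith⟩
    · rw [(isOpen_lt (continuous_of_le_add_dist hb) continuous_const).interior_eq]
      exact fun h => (show b z < t from h).ne hz
  have hlip : LipschitzOnWith 1 γ (Icc 0 L) := LipschitzOnWith.of_dist_le_mul fun s hs t ht => by
    simpa [Real.dist_eq] using hd s hs t ht
  have hcont : ContinuousOn (fun s => b (γ s)) (Icc 0 L) :=
    (continuous_of_le_add_dist hb).comp_continuousOn hlip.continuousOn
  have hx' : t ≤ b (γ 0) := by rw [h0]; exact not_lt.1 hx
  have hy' : t ≤ b (γ L) := by rw [h1]; exact not_lt.1 hy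
  by_cases hmeet : ∃ s ∈ Icc 0 L, b (γ s) < t
  swap
  · push Not at hmeet
    have hj : JoinedByCurve S L x y := ⟨γ, h0, h1, hL, fun s hs =>
      (hγS s hs).resolve_right (not_lt.2 (hmeet s hs)), hd⟩
    exact hj.mono Subset.rfl (le_detourLength hL)
  obtain ⟨u, hu, hut⟩ := hmeet
  -- crossings of the level set on both sides of a point inside
  have left : ∀ v ∈ Icc 0 L, b (γ v) < t → ∃ s ∈ Icc 0 v, b (γ s) = t := fun v hv hvt =>
    intermediate_value_Icc' hv.1 (hcont.mono (Icc_subset_Icc_right hv.2)) ⟨hvt.le, hx'⟩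
  have right : ∀ v ∈ Icc 0 L, b (γ v) < t → ∃ s ∈ Icc v L, b (γ s) = t := fun v hv hvt =>
    intermediate_value_Icc hv.2 (hcont.mono (Icc_subset_Icc_left hv.1)) ⟨hvt.le, hy'⟩
  -- The times on the horosphere form a compact set. Before the first and after the last of them the
  -- curve avoids `B`, since a point inside would force a further crossing.
  let Z : Set ℝ := Icc 0 L ∩ (fun s => b (γ s)) ⁻¹' {t}
  have hZc : IsCompact Z :=
    isCompact_Icc.of_isClosed_subset (hcont.preimage_isClosed_of_isClosed isClosed_Icc
      isClosed_singleton) inter_subset_left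
  have hZ : Z.Nonempty := by
    obtain ⟨s, hs, hst⟩ := left u hu hut
    exact ⟨s, ⟨hs.1, hs.2.trans hu.2⟩, hst⟩
  obtain ⟨s₀, ⟨hs₀, hs₀t⟩, hmin⟩ := hZc.exists_isLeast hZ
  obtain ⟨s₁, ⟨hs₁, hs₁t⟩, hmax⟩ := hZc.exists_isGreatest hZ
  have h01 : s₀ ≤ s₁ := hmin ⟨hs₁, hs₁t⟩
  have c1 : JoinedByCurve S s₀ x (γ s₀) := by
    refine ⟨γ, h0, rfl, hs₀.1, fun s hs => ?_, fun s hs r hr => hd s ⟨hs.1, hs.2.trans hs₀.2⟩ r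
      ⟨hr.1, hr.2.trans hs₀.2⟩⟩
    have hsL : s ∈ Icc 0 L := ⟨hs.1, hs.2.trans hs₀.2⟩
    refine (hγS s hsL).resolve_right fun hsB => ?_
    obtain ⟨r, hr, hrt⟩ := left s hsL hsB
    have : s₀ ≤ r := hmin ⟨⟨hr.1, hr.2.trans hsL.2⟩, hrt⟩
    have hss : s = s₀ := le_antisymm hs.2 (this.trans hr.2)
    rw [hss] at hsB
    exact (show b (γ s₀) < t from hsB).ne hs₀t
  have c3 : JoinedByCurve S (L - s₁) (γ s₁) y := by
    refine ⟨fun s => γ (s + s₁), by simp, by simp [h1], by linarith [hs₁.2], fun s hs => ?_,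
      fun s hs r hr => ?_⟩
    · have hsL : s + s₁ ∈ Icc 0 L := ⟨by linarith [hs.1, hs₁.1], by linarith [hs.2]⟩
      refine (hγS _ hsL).resolve_right fun hsB => ?_
      obtain ⟨r, hr, hrt⟩ := right _ hsL hsB
      have h2 : r ≤ s₁ := hmax ⟨⟨hsL.1.trans hr.1, hr.2⟩, hrt⟩
      have hss : s + s₁ = s₁ := le_antisymm (hr.1.trans h2) (by linarith [hs.1])
      rw [hss] at hsB
      exact (show b (γ s₁) < t from hsB).ne hs₁t
    · refine (hd _ ⟨by linarith [hs.1, hs₁.1], by linarith [hs.2]⟩ _ ⟨by linarith [hr.1, hs₁.1],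
        by linarith [hr.2]⟩).trans (by simp)
  have c2 : JoinedByCurve S (Real.sinh (dist (γ s₀) (γ s₁))) (γ s₀) (γ s₁) :=
    (hcon _ _ hs₀t hs₁t).mono (fun z hz => hlevel z hz) le_rfl
  -- The total length is `s₀ + sinh (dist (γ s₀) (γ s₁)) + (L - s₁)`, where `s₀ ≤ s₁` and the
  -- distance is at most `L`.
  refine ((c1.trans c2).trans c3).mono Subset.rfl ?_
  have h2 : dist (γ s₀) (γ s₁) ≤ L := by
    refine (hd s₀ hs₀ s₁ hs₁).trans ?_
    rw [abs_sub_comm, abs_of_nonneg (by linarith)]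
    linarith [hs₀.1, hs₁.2]
  have h3 := Real.sinh_le_sinh.2 h2
  rw [detourLength]
  linarith

/-- Induction on the horoballs still to be avoided. The frontier of one horoball misses all of them:
it misses the horoball itself by openness, and a point of it in another would make the two
intersect. -/
theorem JoinedByCurve.detour_finset {𝓑 : Set (Set Y)} (h𝓑 : ∀ B ∈ 𝓑, IsDetourable B)
    (hdisj : 𝓑.PairwiseDisjoint id) {x y : Y} (hx : x ∈ (⋃₀ 𝓑)ᶜ) (hy : y ∈ (⋃₀ 𝓑)ᶜ)
    (T : Finset (Set Y)) (hT : ∀ B ∈ T, B ∈ 𝓑) {L : ℝ}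
    (h : JoinedByCurve ((⋃₀ 𝓑)ᶜ ∪ ⋃ B ∈ T, B) L x y) :
    JoinedByCurve (⋃₀ 𝓑)ᶜ (detourLength^[T.card] L) x y := by
  classical
  induction T using Finset.induction_on generalizing L with
  | empty => simpa using h
  | insert B T hBT ih =>
    have hB : B ∈ 𝓑 := hT B (Finset.mem_insert_self _ _)
    rw [Finset.card_insert_of_notMem hBT, Function.iterate_succ_apply]
    refine ih (fun C hC => hT C (Finset.mem_insert_of_mem hC)) ?_
    refine JoinedByCurve.detour (B := B) (h.mono ?_ le_rfl) (h𝓑 B hB) (fun z hz => Or.inl ?_)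
      (fun hxB => hx ⟨B, hB, hxB⟩) (fun hyB => hy ⟨B, hB, hyB⟩)
    · rw [Finset.set_biUnion_insert, union_comm B, union_assoc]
    · rintro ⟨C, hC, hzC⟩
      by_cases hBC : B = C
      · subst hBC
        exact hz.2 (by rwa [(h𝓑 B hB).isOpen.interior_eq])
      · obtain ⟨w, hwC, hwB⟩ := mem_closure_iff.1 hz.1 C (h𝓑 C hC).isOpen hzC
        exact Set.disjoint_left.1 (hdisj hB hC hBC) hwB hwC

/-- The complement of disjoint horoballs in a homogeneous space with uniformly compact balls and
uniformly short curves has uniformly short curves. -/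
theorem exists_joinedByCurve_compl {o : Y} (hhom : ∀ x : Y, ∃ g : Y → Y, Isometry g ∧ g x = o)
    (hcpt : ∀ R, TotallyBounded (Metric.closedBall o R))
    {G : ℝ → ℝ} (hG : Monotone G) (hcurve : ∀ x y : Y, JoinedByCurve univ (G (dist x y)) x y)
    {𝓑 : Set (Set Y)} (h𝓑 : ∀ B ∈ 𝓑, IsDetourable B) (hdisj : 𝓑.PairwiseDisjoint id) (R : ℝ) :
    ∃ M : ℝ, ∀ x y, x ∈ (⋃₀ 𝓑)ᶜ → y ∈ (⋃₀ 𝓑)ᶜ → dist x y ≤ R →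
      JoinedByCurve (⋃₀ 𝓑)ᶜ M x y := by
  -- The centres of the unit balls below lie within `1` of points of the ball of radius `G R`. Mesh
  -- `1 / 2` makes two centres near the same net point less than `1` apart.
  obtain ⟨A, hA, hcover⟩ := Metric.totallyBounded_iff.1 (hcpt (G R + 1)) (1 / 2) (by norm_num)
  refine ⟨detourLength^[A.ncard] (G R), fun x y hx hy hxy => ?_⟩
  have hj := (hcurve x y).mono Subset.rfl (hG hxy)
  obtain ⟨γ, h0, h1, hL, -, hd⟩ := hj
  have hball : ∀ s ∈ Icc 0 (G R), dist x (γ s) ≤ G R := fun s hs => by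
    have := hd 0 ⟨le_rfl, hL⟩ s hs
    rw [h0, zero_sub, abs_neg, abs_of_nonneg hs.1] at this
    exact this.trans hs.2
  obtain ⟨g, hg, hgx⟩ := hhom x
  let 𝓒 : Set (Set Y) := {B ∈ 𝓑 | ∃ z ∈ B, dist x z ≤ G R}
  have hc : ∀ B : 𝓒, ∃ c, ∃ a ∈ A, dist x c ≤ G R + 1 ∧ Metric.ball c 1 ⊆ B ∧
      dist (g c) a < 1 / 2 := by
    rintro ⟨B, hB, z, hz, hzx⟩
    obtain ⟨c, hc, hcB⟩ := (h𝓑 B hB).exists_ball_subset hz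
    have hxc : dist x c ≤ G R + 1 := by linarith [dist_triangle x z c]
    have : g c ∈ Metric.closedBall o (G R + 1) := by
      rw [Metric.mem_closedBall, ← hgx, hg.dist_eq, dist_comm]; exact hxc
    obtain ⟨a, ha, hac⟩ := mem_iUnion₂.1 (hcover this)
    exact ⟨c, a, ha, hxc, hcB, hac⟩
  choose c a ha hxc hcB hca using hc
  have : Finite A := hA
  let φ : 𝓒 → A := fun B => ⟨a B, ha B⟩
  -- If two horoballs shared a net point, the centre chosen for one would lie in the unit ball
  -- contained in the other.
  have hφ : Function.Injective φ := by
    intro B C hBC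
    have haBC : a B = a C := congrArg Subtype.val hBC
    by_contra hne
    have hne' : (B : Set Y) ≠ C := fun h => hne (Subtype.ext h)
    have h1 : dist (c B) (c C) < 1 := by
      rw [← hg.dist_eq]
      have e1 := hca B
      have e2 := hca C
      rw [← haBC] at e2
      linarith [dist_triangle_right (g (c B)) (g (c C)) (a B)]
    refine Set.disjoint_left.1 (hdisj B.2.1 C.2.1 hne') (hcB B (?_ : c C ∈ _))
      (hcB C (Metric.mem_ball_self one_pos))
    rwa [Metric.mem_ball, dist_comm]
  have hfin : 𝓒.Finite := Finite.of_injective φ hφ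
  have hcard : hfin.toFinset.card ≤ A.ncard := by
    rw [← Set.ncard_eq_toFinset_card 𝓒 hfin]
    exact Nat.card_le_card_of_injective φ hφ
  have hγ : JoinedByCurve ((⋃₀ 𝓑)ᶜ ∪ ⋃ B ∈ hfin.toFinset, B) (G R) x y := by
    refine ⟨γ, h0, h1, hL, fun s hs => ?_, hd⟩
    by_cases hsB : γ s ∈ ⋃₀ 𝓑
    · obtain ⟨B, hB, hsB⟩ := hsB
      exact Or.inr (mem_iUnion₂.2 ⟨B, hfin.mem_toFinset.2 ⟨hB, γ s, hsB, hball s hs⟩, hsB⟩)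
    · exact Or.inl hsB
  exact (hγ.detour_finset h𝓑 hdisj hx hy _ fun B hB => (hfin.mem_toFinset.1 hB).1).mono
    Subset.rfl (iterate_detourLength_mono hL hcard)

/-- A subset in which nearby points are joined by uniformly short curves is coarsely embedded. -/
theorem isCoarseEmbedding_of_joinedByCurve {Ω : Set Y}
    (h : ∀ R : ℝ, ∃ M : ℝ, ∀ x y, x ∈ Ω → y ∈ Ω → dist x y ≤ R → JoinedByCurve Ω M x y) :
    (∀ x y : Ω, pathEDist x y ≠ ∞) ∧
      IsCoarseEmbedding (fun x y : Ω => (pathEDist x y).toNNReal)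
        (fun x y : Y => nndist x y) (Subtype.val : Ω → Y) := by
  have hfin : ∀ x y : Ω, pathEDist x y ≠ ∞ := fun x y => by
    obtain ⟨M, hM⟩ := h (dist (x : Y) y)
    exact ne_top_of_le_ne_top ENNReal.ofReal_ne_top (hM x y x.2 y.2 le_rfl).pathEDist_le
  refine ⟨hfin, ?_⟩
  -- `α t` is the least `d_X` among pairs with `d_Ω ≥ t`, cut off at `t`. The ray `Ici t` keeps the
  -- set nonempty and gives `α t ≤ t = ω t`.
  let S : ℝ≥0 → Set ℝ := fun t =>
    {v | ∃ x y : Ω, t ≤ (pathEDist x y).toNNReal ∧ v = dist (x : Y) y} ∪ Ici (t : ℝ)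
  have hbdd : ∀ t, BddBelow (S t) := fun t => by
    refine ⟨0, ?_⟩
    rintro v (⟨x, y, -, rfl⟩ | hv)
    · exact dist_nonneg
    · exact t.2.trans hv
  have hmem : ∀ t : ℝ≥0, (t : ℝ) ∈ S t := fun t => Or.inr (mem_Ici.2 le_rfl)
  refine ⟨fun t => sInf (S t), fun t => t, ?_, NNReal.coe_mono, fun t => csInf_le (hbdd t) (hmem t),
    ?_, fun x y => ⟨csInf_le (hbdd _) (Or.inl ⟨x, y, le_rfl, rfl⟩), ?_⟩⟩
  · intro s t hst
    refine csInf_le_csInf (hbdd s) ⟨_, hmem t⟩ ?_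
    rintro v (⟨x, y, hxy, rfl⟩ | hv)
    · exact Or.inl ⟨x, y, hst.trans hxy, rfl⟩
    · exact Or.inr ((NNReal.coe_le_coe.2 hst).trans hv)
  · refine tendsto_atTop.2 fun R => ?_
    obtain ⟨M, hM⟩ := h R
    -- Beyond `M` no pair with `d_Ω ≥ t` has `d_X < R`; beyond `R` the ray `Ici t` lies above `R` as
    -- well.
    filter_upwards [eventually_gt_atTop (max M.toNNReal R.toNNReal)] with t ht
    refine le_csInf ⟨_, hmem t⟩ ?_
    rintro v (⟨x, y, hxy, rfl⟩ | hv)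
    · by_contra! hlt
      have e1 := ENNReal.toNNReal_mono ENNReal.ofReal_ne_top
        (hM x y x.2 y.2 hlt.le).pathEDist_le
      have e2 : (ENNReal.ofReal M).toNNReal = M.toNNReal := rfl
      rw [e2] at e1
      exact absurd ((le_max_left _ _).trans_lt ht) (not_lt.2 (hxy.trans e1))
    · exact (Real.le_coe_toNNReal R).trans
        ((NNReal.coe_le_coe.2 ((le_max_right _ _).trans ht.le)).trans hv)
  · have e := ENNReal.toNNReal_mono (hfin x y) (edist_le_pathEDist x y)
    rw [edist_nndist, ENNReal.toNNReal_coe] at e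
    exact NNReal.coe_le_coe.2 e

end Detours

end RankOne
namespace RankOne

/-! ### Identities in Hurwitz algebras -/

namespace HurwitzAlgebra

variable {K : Type} [NormedAddCommGroup K] [InnerProductSpace ℝ K] [HurwitzAlgebra K]

theorem inner_one_left (a : K) : inner ℝ (one : K) a = re a := rfl

/-- Polarization of `norm_mul'` in the left factor. -/
theorem inner_mul_right (x y a : K) : inner ℝ (mul x a) (mul y a) = ‖a‖ ^ 2 * inner ℝ x y := by
  have h := congrArg (· ^ 2) (norm_mul' (x + y) a)
  simp only [map_add, LinearMap.add_apply, mul_pow, norm_add_sq_real, norm_mul'] at h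
  linarith

theorem inner_mul_mul_add (x y a b : K) :
    inner ℝ (mul x a) (mul y b) + inner ℝ (mul x b) (mul y a) =
      2 * inner ℝ x y * inner ℝ a b := by
  have h := inner_mul_right x y (a + b)
  simp only [map_add, inner_add_left, inner_add_right, norm_add_sq_real, inner_mul_right] at h
  linarith

/-- The doubly polarized norm identity at `b = one` makes right multiplication by `conj a` adjoint
to that by `a`. With `inner_mul_eq_inner_conj_mul` it replaces associativity. -/
theorem inner_mul_eq_inner_mul_conj (x y a : K) :
    inner ℝ (mul x a) y = inner ℝ x (mul y (conj a)) := by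
  have h := inner_mul_mul_add x y a one
  rw [mul_one', mul_one', real_inner_comm one a, inner_one_left] at h
  rw [conj_eq', map_sub, map_smul, mul_one', inner_sub_right, inner_smul_right]
  linarith

theorem mul_mul_conj (x a : K) : mul (mul x a) (conj a) = (‖a‖ ^ 2) • x := by
  refine ext_inner_left ℝ fun y => ?_
  rw [← inner_mul_eq_inner_mul_conj, inner_mul_right, inner_smul_right]

theorem mul_conj_mul (x a : K) : mul (mul x (conj a)) a = (‖a‖ ^ 2) • x := by
  have := mul_mul_conj x (conj a)
  rwa [conj_conj, norm_conj] at this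

theorem inner_conj_conj (a b : K) : inner ℝ (conj a) (conj b) = inner ℝ a b := by
  have h := congrArg (· ^ 2) (norm_conj (a + b))
  simp only [map_add, norm_add_sq_real, norm_conj] at h
  linarith

theorem inner_conj_left (a b : K) : inner ℝ (conj a) b = inner ℝ a (conj b) := by
  rw [← inner_conj_conj, conj_conj]

theorem inner_mul_left (a x y : K) : inner ℝ (mul a x) (mul a y) = ‖a‖ ^ 2 * inner ℝ x y := by
  have h := congrArg (· ^ 2) (norm_mul' a (x + y))
  simp only [map_add, mul_pow, norm_add_sq_real, norm_mul'] at h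
  linarith

theorem inner_mul_eq_inner_conj_mul (a x y : K) :
    inner ℝ (mul a x) y = inner ℝ x (mul (conj a) y) := by
  have h := inner_mul_left (a + one) x y
  simp only [map_add, LinearMap.add_apply, inner_add_left, inner_add_right, norm_add_sq_real,
    inner_mul_left, one_mul', norm_one', real_inner_comm one a, inner_one_left] at h
  rw [conj_eq', map_sub, map_smul, LinearMap.sub_apply, LinearMap.smul_apply, one_mul',
    inner_sub_right, inner_smul_right]
  linarith

theorem conj_of_re_eq_zero {a : K} (h : re a = 0) : conj a = -a := by
  rw [conj_eq', h]; simp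

theorem norm_smul_one_add_sq {u : K} (hu : re u = 0) (c d : ℝ) :
    ‖c • (one : K) + d • u‖ ^ 2 = c ^ 2 + d ^ 2 * ‖u‖ ^ 2 := by
  rw [norm_add_sq_real, inner_smul_left, inner_smul_right, inner_one_left, hu, norm_smul, norm_smul,
    norm_one', mul_pow, mul_pow, Real.norm_eq_abs, Real.norm_eq_abs, sq_abs, sq_abs]
  simp

/-! ### Hermitian products and coordinatewise right multiplication. -/

section
variable {m : ℕ} (x y z : PiLp 2 (fun _ : Fin m => K))

theorem sesq_add_left : sesq (x + y) z = sesq x z + sesq y z := by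
  simp [sesq, Finset.sum_add_distrib]

theorem sesq_add_right : sesq x (y + z) = sesq x y + sesq x z := by
  simp [sesq, Finset.sum_add_distrib]

theorem sesq_smul_left (c : ℝ) : sesq (c • x) y = c • sesq x y := by
  simp [sesq, Finset.smul_sum]

theorem sesq_smul_right (c : ℝ) : sesq x (c • y) = c • sesq x y := by
  simp [sesq, Finset.smul_sum]

theorem sesq_neg_left : sesq (-x) y = -sesq x y := by
  simp [sesq]

/-- Coordinatewise right multiplication. -/
def vecMul (a : K) : PiLp 2 (fun _ : Fin m => K) := WithLp.toLp 2 fun i => mul (x i) a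

theorem norm_vecMul_sq (a : K) : ‖vecMul x a‖ ^ 2 = ‖a‖ ^ 2 * ‖x‖ ^ 2 := by
  simp only [PiLp.norm_sq_eq_of_L2, vecMul, norm_mul', mul_pow, Finset.mul_sum]
  exact Finset.sum_congr rfl fun i _ => mul_comm _ _

theorem vecMul_smul (c : ℝ) (a : K) : vecMul (c • x) a = c • vecMul x a := by
  ext i; simp [vecMul]

theorem vecMul_smul_right (c : ℝ) (a : K) : vecMul x (c • a) = c • vecMul x a := by
  ext i; simp [vecMul]

theorem vecMul_conj_vecMul (a : K) : vecMul (vecMul x (conj a)) a = (‖a‖ ^ 2) • x := by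
  ext i; simp [vecMul, mul_conj_mul]

end

/-- Right multiplications scale the norm of the Hermitian product on `Kᵐ`. This holds if `K` is
associative or `m ≤ 1`. -/
def SesqNormMul (K : Type) [NormedAddCommGroup K] [InnerProductSpace ℝ K] [HurwitzAlgebra K]
    (m : ℕ) : Prop :=
  ∀ (x y : PiLp 2 (fun _ : Fin m => K)) (a b : K),
    ‖sesq (vecMul x a) (vecMul y b)‖ = ‖a‖ * ‖b‖ * ‖sesq x y‖

theorem sesqNormMul_of_le_one {m : ℕ} (hm : m ≤ 1) : SesqNormMul K m := by
  intro x y a b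
  interval_cases m
  · simp [sesq]
  · simp [sesq, vecMul, norm_mul', norm_conj]; ring

theorem conj_mul (a b : K) : conj (mul a b) = mul (conj b) (conj a) := by
  have := conj_conj_mul (conj a) b
  rwa [conj_conj] at this

theorem sesqNormMul_of_assoc (h : ∀ a b c : K, mul (mul a b) c = mul a (mul b c)) (m : ℕ) :
    SesqNormMul K m := by
  intro x y a b
  have : sesq (vecMul x a) (vecMul y b) = mul (conj a) (mul (sesq x y) b) := by
    simp [sesq, vecMul, conj_mul, h]
  rw [this, norm_mul', norm_mul', norm_conj]
  ring

/-- This is the cross term in the expansion of the norm in `norm_inversion`. It is computed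
coordinate by coordinate from the adjoint rules and `mul_conj_mul`, hence without associativity. -/
theorem inner_conj_add_sesq_vecMul {m : ℕ} (x y : PiLp 2 (fun _ : Fin m => K)) (a b : K) :
    inner ℝ ((‖b‖ ^ 2) • a + (‖a‖ ^ 2) • conj b) (sesq (vecMul x (conj a)) (vecMul y (conj b))) =
      ‖a‖ ^ 2 * ‖b‖ ^ 2 * inner ℝ (conj a + b) (sesq x y) := by
  have h1 (x y : K) : inner ℝ a (mul (conj (mul x (conj a))) (mul y (conj b))) =
      ‖a‖ ^ 2 * inner ℝ b (mul (conj x) y) := by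
    rw [← inner_mul_eq_inner_conj_mul, mul_conj_mul, inner_smul_left,
      ← inner_mul_eq_inner_mul_conj, inner_mul_eq_inner_conj_mul]
    simp
  have h2 (x y : K) : inner ℝ (conj b) (mul (conj (mul x (conj a))) (mul y (conj b))) =
      ‖b‖ ^ 2 * inner ℝ (conj a) (mul (conj x) y) := by
    rw [← inner_mul_eq_inner_conj_mul, inner_mul_right, norm_conj, inner_mul_eq_inner_conj_mul]
  simp only [sesq, inner_add_left, inner_smul_left, inner_sum, vecMul, h1, h2, conj_trivial,
    Finset.mul_sum]
  exact Finset.sum_congr rfl fun i _ => by ring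

/-- The Hermitian form behaves under inversion as over an associative algebra. -/
theorem norm_inversion {m : ℕ} (hK : SesqNormMul K m) (x y : PiLp 2 (fun _ : Fin m => K))
    (a b : K) :
    ‖(‖b‖ ^ 2) • a + (‖a‖ ^ 2) • conj b - (2 : ℝ) • sesq (vecMul x (conj a)) (vecMul y (conj b))‖ =
      ‖a‖ * ‖b‖ * ‖conj a + b - (2 : ℝ) • sesq x y‖ := by
  rw [← sq_eq_sq₀ (norm_nonneg _) (by positivity), mul_pow, mul_pow, norm_sub_sq_real,
    norm_sub_sq_real (conj a + b), inner_smul_right, inner_conj_add_sesq_vecMul, inner_smul_right,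
    norm_smul, norm_smul, hK, norm_conj, norm_conj, norm_add_sq_real, norm_add_sq_real, norm_smul,
    norm_smul, norm_conj, norm_conj, inner_smul_left, inner_smul_right, inner_conj_left]
  simp only [norm_pow, norm_norm, conj_trivial, Real.norm_ofNat]
  ring

end HurwitzAlgebra

open HurwitzAlgebra

namespace HypSpace

/-! ### Isometries of the hyperbolic spaces -/

variable {K : Type} [NormedAddCommGroup K] [InnerProductSpace ℝ K] [HurwitzAlgebra K] {n : ℕ}

theorem dist_eq_arcosh (p q : HypSpace K n) : dist p q = Real.arcosh (coshDist p q) := rfl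

/-- `coshDist` is homogeneous of degree zero in each argument, so the weights cancel. -/
theorem isometry_of_herm {f : HypSpace K n → HypSpace K n} (w : HypSpace K n → ℝ)
    (hw : ∀ p, 0 < w p) (hh : ∀ p, (f p).height = w p ^ 2 * p.height)
    (hf : ∀ p q, ‖herm (f p) (f q)‖ = w p * w q * ‖herm p q‖) : Isometry f := by
  refine Isometry.of_dist_eq fun p q => ?_
  rw [dist_eq_arcosh, dist_eq_arcosh]
  congr 1
  have h1 := hw p
  have h2 := hw q
  rw [coshDist, coshDist, hf, hh, hh, show w p ^ 2 * p.height * (w q ^ 2 * q.height) =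
    (w p * w q) ^ 2 * (p.height * q.height) by ring, Real.sqrt_mul (by positivity),
    Real.sqrt_sq (by positivity), mul_left_comm, mul_div_mul_left _ _ (by positivity)]

/-- The translation by the boundary point `(v, a)` of the generalized Heisenberg group. -/
def heis (v : PiLp 2 (fun _ : Fin (n - 1) => K)) (a : K) (h : re a = ‖v‖ ^ 2)
    (p : HypSpace K n) : HypSpace K n where
  vec := p.vec + v
  last := p.last + (2 : ℝ) • sesq v p.vec + a
  norm_sq_lt := by
    have := p.norm_sq_lt
    rw [re_add, re_add, re_smul, re_sesq, norm_add_sq_real, real_inner_comm]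
    linarith

section heis

variable (v : PiLp 2 (fun _ : Fin (n - 1) => K)) (a : K) (h : re a = ‖v‖ ^ 2)

theorem height_heis (p : HypSpace K n) : (heis v a h p).height = p.height := by
  simp only [height, heis, re_add, re_smul, re_sesq, norm_add_sq_real, real_inner_comm p.vec v]
  linarith

theorem isometry_heis : Isometry (heis (n := n) v a h) := by
  refine isometry_of_herm (fun _ => 1) (fun _ => one_pos) (fun p => by simp [height_heis])
    fun p q => ?_
  rw [one_mul, one_mul]
  congr 1
  simp only [herm, heis, map_add, map_smul, conj_sesq, sesq_add_left, sesq_add_right, sesq_self,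
    conj_eq' a, h]
  module

theorem heis_heis_neg (p : HypSpace K n) :
    heis (-v) (conj a) (by rw [re_conj, norm_neg, h]) (heis v a h p) = p := by
  ext1
  · simp [heis]
  · simp only [heis, sesq_neg_left, sesq_add_right, sesq_self, conj_eq' a, h]
    module

end heis

/-- Translations as isometric equivalences. -/
def heisEquiv (v : PiLp 2 (fun _ : Fin (n - 1) => K)) (a : K) (h : re a = ‖v‖ ^ 2) :
    HypSpace K n ≃ᵢ HypSpace K n where
  toFun := heis v a h
  invFun := heis (-v) (conj a) (by rw [re_conj, norm_neg, h])
  left_inv := heis_heis_neg v a h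
  right_inv p := by
    have := heis_heis_neg (-v) (conj a) (by rw [re_conj, norm_neg, h]) p
    simpa only [neg_neg, conj_conj] using this
  isometry_toFun := isometry_heis v a h

/-- The dilation `(x, a) ↦ (r x, r² a)`. -/
def dilate (r : ℝ) (hr : 0 < r) (p : HypSpace K n) : HypSpace K n where
  vec := r • p.vec
  last := (r ^ 2) • p.last
  norm_sq_lt := by
    rw [norm_smul, re_smul, mul_pow, Real.norm_eq_abs, sq_abs]
    exact mul_lt_mul_of_pos_left p.norm_sq_lt (by positivity)

theorem isometry_dilate (r : ℝ) (hr : 0 < r) : Isometry (dilate (K := K) (n := n) r hr) := by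
  refine isometry_of_herm (fun _ => r) (fun _ => hr) (fun p => ?_) fun p q => ?_
  · simp only [height, dilate, re_smul, norm_smul, Real.norm_eq_abs, mul_pow, sq_abs]
    ring
  · have : herm (dilate r hr p) (dilate r hr q) = (r * r) • herm p q := by
      simp only [herm, dilate, map_smul, sesq_smul_left, sesq_smul_right]
      module
    rw [this, norm_smul, Real.norm_of_nonneg (by positivity)]

/-- The point `(0, 1)`. -/
def base : HypSpace K n where
  vec := 0
  last := one
  norm_sq_lt := by simp [re_one]

theorem exists_isometry_eq_base (p : HypSpace K n) :
    ∃ g : HypSpace K n → HypSpace K n, Isometry g ∧ g p = base := by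
  have hp := p.height_pos
  have hr : 0 < √(p.height)⁻¹ := by positivity
  -- This translation takes `p` to `(0, p.height)`; the dilation then normalizes the height to `1`.
  have h : re (conj p.last - p.height • one) = ‖-p.vec‖ ^ 2 := by
    rw [re_sub, re_conj, re_smul, re_one, height, norm_neg]; ring
  refine ⟨_, (isometry_dilate _ hr).comp (isometry_heis _ _ h), ?_⟩
  ext1
  · simp [dilate, heis, base]
  · simp only [Function.comp, dilate, heis, base, sesq_neg_left, sesq_self, conj_eq' p.last]
    rw [Real.sq_sqrt (by positivity)]
    have : p.last + (2 : ℝ) • -(‖p.vec‖ ^ 2 • (one : K)) +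
        ((2 * re p.last) • one - p.last - p.height • one) = p.height • one := by
      rw [height]; module
    rw [this, smul_smul, inv_mul_cancel₀ hp.ne', one_smul]

theorem re_last_pos (p : HypSpace K n) : 0 < re p.last :=
  (sq_nonneg _).trans_lt p.norm_sq_lt

theorem norm_last_pos (p : HypSpace K n) : 0 < ‖p.last‖ := p.re_last_pos.trans_le (re_le_norm _)

/-- The inversion which exchanges the boundary points `0` and `∞`. -/
noncomputable def inversion (p : HypSpace K n) : HypSpace K n where
  vec := (‖p.last‖ ^ 2)⁻¹ • vecMul p.vec (conj p.last)
  last := (‖p.last‖ ^ 2)⁻¹ • conj p.last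
  norm_sq_lt := by
    have h := p.norm_last_pos
    rw [norm_smul, mul_pow, norm_vecMul_sq, norm_conj, re_smul, re_conj,
      Real.norm_of_nonneg (by positivity)]
    have : (‖p.last‖ ^ 2)⁻¹ ^ 2 * (‖p.last‖ ^ 2 * ‖p.vec‖ ^ 2) =
        (‖p.last‖ ^ 2)⁻¹ * ‖p.vec‖ ^ 2 := by field_simp
    rw [this]
    exact mul_lt_mul_of_pos_left p.norm_sq_lt (by positivity)

theorem height_inversion (p : HypSpace K n) :
    (inversion p).height = (‖p.last‖⁻¹) ^ 2 * p.height := by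
  have h := p.norm_last_pos
  simp only [height, inversion]
  rw [norm_smul, mul_pow, norm_vecMul_sq, norm_conj, re_smul, re_conj,
      Real.norm_of_nonneg (by positivity)]
  field_simp

theorem inversion_inversion (p : HypSpace K n) : inversion (inversion p) = p := by
  have h := p.norm_last_pos
  have e : ‖(inversion p).last‖ ^ 2 = (‖p.last‖ ^ 2)⁻¹ := by
    simp only [inversion]
    rw [norm_smul, mul_pow, norm_conj, Real.norm_of_nonneg (by positivity)]
    field_simp
  have e' : conj (inversion p).last = (‖p.last‖ ^ 2)⁻¹ • p.last := by
    simp only [inversion]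
    rw [map_smul, conj_conj]
  have h2 : ‖p.last‖ ^ 2 ≠ 0 := by positivity
  ext1
  · change (‖(inversion p).last‖ ^ 2)⁻¹ • vecMul (inversion p).vec (conj (inversion p).last) = _
    rw [e, e']
    simp only [inversion]
    rw [vecMul_smul, vecMul_smul_right, vecMul_conj_vecMul, smul_smul, smul_smul, smul_smul]
    convert one_smul ℝ p.vec
    field_simp
  · change (‖(inversion p).last‖ ^ 2)⁻¹ • conj (inversion p).last = _
    rw [e, e', smul_smul, inv_inv, mul_inv_cancel₀ h2, one_smul]

/-- Inversion is `(x, a) ↦ (x a⁻¹, a⁻¹)`; it multiplies the form by the weights `‖p.last‖⁻¹` and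
`‖q.last‖⁻¹` in norm. -/
theorem isometry_inversion (hK : SesqNormMul K (n - 1)) :
    Isometry (inversion (K := K) (n := n)) := by
  refine isometry_of_herm (fun p => ‖p.last‖⁻¹) (fun p => inv_pos.2 p.norm_last_pos)
    height_inversion fun p q => ?_
  have hp := p.norm_last_pos
  have hq := q.norm_last_pos
  have e : herm (inversion p) (inversion q) = (‖p.last‖⁻¹ ^ 2 * ‖q.last‖⁻¹ ^ 2) •
      ((‖q.last‖ ^ 2) • p.last + (‖p.last‖ ^ 2) • conj q.last -
        (2 : ℝ) • sesq (vecMul p.vec (conj p.last)) (vecMul q.vec (conj q.last))) := by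
    simp only [herm, inversion, map_smul, conj_conj, sesq_smul_left, sesq_smul_right]
    match_scalars <;> field_simp
  rw [e, norm_smul, norm_inversion hK, Real.norm_of_nonneg (by positivity), herm]
  field_simp

/-- The inversion as an isometric equivalence. -/
noncomputable def inversionEquiv (hK : SesqNormMul K (n - 1)) : HypSpace K n ≃ᵢ HypSpace K n where
  toFun := inversion
  invFun := inversion
  left_inv := inversion_inversion
  right_inv := inversion_inversion
  isometry_toFun := isometry_inversion hK

end HypSpace

end RankOne
namespace RankOne

open HurwitzAlgebra

namespace HypSpace

variable {K : Type} [NormedAddCommGroup K] [InnerProductSpace ℝ K] [HurwitzAlgebra K] {n : ℕ}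

/-! ### Horospherical coordinates -/

theorem sinh_dist_sq (p q : HypSpace K n) :
    Real.sinh (dist p q) ^ 2 = ‖herm p q‖ ^ 2 / (4 * (p.height * q.height)) - 1 := by
  rw [Real.sinh_sq, dist_eq_arcosh, Real.cosh_arcosh (one_le_coshDist p q), coshDist_sq]

/-- The Busemann function of the boundary point `∞`. -/
noncomputable def busemannInfty (p : HypSpace K n) : ℝ := -(Real.log p.height) / 2

/-- The point at signed distance `s` above `p` on the vertical geodesic through `p`. -/
noncomputable def up (s : ℝ) (p : HypSpace K n) : HypSpace K n where
  vec := p.vec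
  last := p.last + ((Real.exp (2 * s) - 1) * p.height) • one
  norm_sq_lt := by
    have h : 0 < Real.exp (2 * s) * p.height := mul_pos (Real.exp_pos _) p.height_pos
    rw [re_add, re_smul, re_one]
    rw [height] at h ⊢
    linarith

theorem height_up (s : ℝ) (p : HypSpace K n) : (up s p).height = Real.exp (2 * s) * p.height := by
  simp only [height, up, re_add, re_smul, re_one]
  ring

theorem busemannInfty_up (s : ℝ) (p : HypSpace K n) :
    busemannInfty (up s p) = busemannInfty p - s := by
  rw [busemannInfty, busemannInfty, height_up, Real.log_mul (Real.exp_pos _).ne' p.height_pos.ne',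
    Real.log_exp]
  ring

theorem up_zero (p : HypSpace K n) : up 0 p = p := by
  ext1 <;> simp [up]

/-- On a vertical line the form is real, and its normalization is exactly `cosh (s - t)`. -/
theorem dist_up_up (s t : ℝ) (p : HypSpace K n) : dist (up s p) (up t p) = |s - t| := by
  have hp := p.height_pos
  rw [dist_eq_arcosh, ← Real.arcosh_cosh (abs_nonneg (s - t)), Real.cosh_abs]
  congr 1
  have e : herm (up s p) (up t p) =
      ((Real.exp (2 * s) + Real.exp (2 * t)) * p.height) • one := by
    simp only [herm, up, sesq_self, map_add, map_smul, conj_one, conj_eq' p.last]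
    rw [height]
    module
  have e2 : Real.exp (2 * s) * p.height * (Real.exp (2 * t) * p.height) =
      (Real.exp (s + t) * p.height) ^ 2 := by
    rw [mul_pow, ← Real.exp_nat_mul, show ((2 : ℕ) : ℝ) * (s + t) = 2 * s + 2 * t by
      push_cast; ring, Real.exp_add]
    ring
  rw [coshDist, e, norm_smul, HurwitzAlgebra.norm_one', height_up, height_up, e2,
    Real.sqrt_sq (by positivity), Real.norm_of_nonneg (by positivity), Real.cosh_eq,
    show 2 * s = (s + t) + (s - t) by ring, show 2 * t = (s + t) + -(s - t) by ring,
    Real.exp_add (s + t) (s - t), Real.exp_add (s + t)]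
  field_simp

theorem dist_up (s : ℝ) (p : HypSpace K n) : dist p (up s p) = |s| := by
  have := dist_up_up 0 s p
  rwa [up_zero, zero_sub, abs_neg] at this

/-- The real part of the form is at least the sum of the heights, which is `2 √(p.height *
q.height)` times the `cosh` of the difference of the Busemann values. -/
theorem busemannInfty_le (p q : HypSpace K n) :
    busemannInfty p ≤ busemannInfty q + dist p q := by
  set x := busemannInfty p - busemannInfty q with hx
  have hp := p.height_pos
  have hq := q.height_pos
  have e (p : HypSpace K n) : √p.height = Real.exp (-busemannInfty p) := by
    rw [busemannInfty, neg_div, neg_neg, ← Real.log_sqrt p.height_pos.le,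
      Real.exp_log (Real.sqrt_pos.2 p.height_pos)]
  have h : Real.cosh x ≤ Real.cosh (dist p q) := by
    rw [cosh_dist, le_div_iff₀ (by positivity)]
    refine le_trans ?_ (re_le_norm _)
    rw [re_herm, Real.sqrt_mul hp.le, e, e, Real.cosh_eq]
    have e1 : p.height = Real.exp (-busemannInfty p) ^ 2 := by rw [← e, Real.sq_sqrt hp.le]
    have e2 : q.height = Real.exp (-busemannInfty q) ^ 2 := by rw [← e, Real.sq_sqrt hq.le]
    rw [e1, e2, hx, neg_sub, Real.exp_sub, Real.exp_sub, Real.exp_neg, Real.exp_neg]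
    have h1 := Real.exp_pos (busemannInfty p)
    have h2 := Real.exp_pos (busemannInfty q)
    refine le_add_of_le_of_nonneg (le_of_eq ?_) (sq_nonneg _)
    field_simp
    ring
  rw [Real.cosh_le_cosh, abs_of_nonneg (dist_nonneg : 0 ≤ dist p q)] at h
  linarith [le_abs_self x]

/-- The standard curve from `p` to `q` in a horosphere about `∞`. -/
noncomputable def horoCurve (p q : HypSpace K n) (h : p.height = q.height) (t : ℝ) : HypSpace K n where
  vec := p.vec + t • (q.vec - p.vec)
  last := p.last + (t ^ 2 * ‖q.vec - p.vec‖ ^ 2) • one +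
    t • (q.last - p.last - (‖q.vec - p.vec‖ ^ 2) • one)
  norm_sq_lt := by
    have hp := p.norm_sq_lt
    rw [height, height] at h
    simp only [re_add, re_smul, re_sub, re_one, norm_add_sq_real, norm_sub_sq_real,
      inner_smul_right, inner_sub_right, norm_smul, mul_pow, real_inner_self_eq_norm_sq,
      real_inner_comm p.vec q.vec, Real.norm_eq_abs, sq_abs]
    linear_combination hp + t * h

section horoCurve

variable (p q : HypSpace K n) (h : p.height = q.height)

theorem horoCurve_zero : horoCurve p q h 0 = p := by
  ext1 <;> simp [horoCurve]

theorem horoCurve_one : horoCurve p q h 1 = q := by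
  ext1 <;> simp [horoCurve]

theorem height_horoCurve (t : ℝ) : (horoCurve p q h t).height = p.height := by
  have h' := h
  simp only [height] at h'
  simp only [height, horoCurve, re_add, re_smul, re_sub, re_one, norm_add_sq_real,
    norm_sub_sq_real, inner_smul_right, inner_sub_right, norm_smul, mul_pow,
    real_inner_self_eq_norm_sq, real_inner_comm p.vec q.vec, Real.norm_eq_abs, sq_abs]
  linear_combination - t * h'

/-- The curve is an orbit of a one-parameter group of translations, so only `t - s` matters. `N` is
the squared norm of the imaginary direction `u`, whose real part vanishes because the heights agree.
-/
theorem norm_herm_horoCurve_sq : ∃ N : ℝ, 0 ≤ N ∧ ∀ s t : ℝ,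
    ‖herm (horoCurve p q h s) (horoCurve p q h t)‖ ^ 2 =
      (2 * p.height + (t - s) ^ 2 * ‖q.vec - p.vec‖ ^ 2) ^ 2 + (t - s) ^ 2 * N := by
  set w := q.vec - p.vec with hw
  set u := q.last - p.last - (‖w‖ ^ 2) • one - (2 : ℝ) • sesq p.vec w with hu
  have hu0 : re u = 0 := by
    simp only [height] at h
    rw [hu, hw]
    simp only [re_smul, re_sub, re_one, re_sesq, norm_sub_sq_real,
      inner_sub_right, real_inner_self_eq_norm_sq, real_inner_comm p.vec q.vec]
    linear_combination - h
  have hlast : q.last = u + p.last + (‖w‖ ^ 2) • one + (2 : ℝ) • sesq p.vec w := by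
    rw [hu]; abel
  have hconj : conj (sesq p.vec w) = sesq w p.vec := conj_sesq _ _
  refine ⟨‖u‖ ^ 2, sq_nonneg _, fun s t => ?_⟩
  have e : herm (horoCurve p q h s) (horoCurve p q h t) =
      (2 * p.height + (t - s) ^ 2 * ‖w‖ ^ 2) • one + (t - s) • u := by
    simp only [herm, horoCurve, ← hw, hlast]
    simp only [map_add, map_sub, map_smul, conj_one, sesq_add_left, sesq_add_right,
      sesq_smul_left, sesq_smul_right, sesq_self, hconj, conj_of_re_eq_zero hu0]
    rw [conj_eq', height]
    module
  rw [e, norm_smul_one_add_sq hu0]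

/-- With `δ = s - t`, `sinh²` of the distance is `δ² (A + δ² B + C)` with nonnegative coefficients,
hence at most `δ²` times its value at `δ = 1`. Finally `d ≤ sinh d`. -/
theorem dist_horoCurve_le {s t : ℝ} (hst : |s - t| ≤ 1) :
    dist (horoCurve p q h s) (horoCurve p q h t) ≤ Real.sinh (dist p q) * |s - t| := by
  obtain ⟨N, hN, hherm⟩ := norm_herm_horoCurve_sq p q h
  have hp := p.height_pos
  have hd : 0 ≤ Real.sinh (dist p q) := Real.sinh_nonneg_iff.2 dist_nonneg
  refine (Real.self_le_sinh_iff.2 dist_nonneg).trans ?_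
  rw [← sq_le_sq₀ (Real.sinh_nonneg_iff.2 dist_nonneg) (by positivity), mul_pow, sq_abs,
    sinh_dist_sq, height_horoCurve, height_horoCurve, hherm]
  have e := hherm 0 1
  rw [horoCurve_zero, horoCurve_one] at e
  rw [sinh_dist_sq, e, ← h]
  have hst2 : (s - t) ^ 2 ≤ 1 := by rwa [sq_le_one_iff_abs_le_one]
  have e1 (δ : ℝ) : ((2 * p.height + δ ^ 2 * ‖q.vec - p.vec‖ ^ 2) ^ 2 + δ ^ 2 * N) /
      (4 * (p.height * p.height)) - 1 = δ ^ 2 * (‖q.vec - p.vec‖ ^ 2 / p.height +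
        δ ^ 2 * (‖q.vec - p.vec‖ ^ 4 / (4 * p.height ^ 2)) + N / (4 * p.height ^ 2)) := by
    field_simp
    ring
  rw [e1, e1, sub_zero, one_pow, one_mul, one_mul, ← neg_sub s t, neg_sq, mul_comm]
  refine mul_le_mul_of_nonneg_right ?_ (sq_nonneg _)
  gcongr
  exact mul_le_of_le_one_left (by positivity) hst2

end horoCurve

/-! ### Short curves in horospheres and in the whole space. -/

theorem joinedByCurve_horosphere {p q : HypSpace K n} (h : p.height = q.height) :
    JoinedByCurve {z : HypSpace K n | z.height = p.height} (Real.sinh (dist p q)) p q := by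
  have hj := joinedByCurve_of_lipschitz (γ := horoCurve p q h) (M := Real.sinh (dist p q))
    (S := {z : HypSpace K n | z.height = p.height})
    (Real.sinh_nonneg_iff.2 dist_nonneg) (fun s _ => height_horoCurve p q h s)
    (fun s hs t ht => dist_horoCurve_le p q h (by
      rw [abs_le]
      constructor <;> linarith [hs.1, hs.2, ht.1, ht.2]))
  rwa [horoCurve_zero, horoCurve_one] at hj

theorem height_eq_of_busemannInfty_eq {p q : HypSpace K n}
    (h : busemannInfty p = busemannInfty q) : p.height = q.height := by
  rw [busemannInfty, busemannInfty] at h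
  exact Real.log_injOn_pos p.height_pos q.height_pos (by linarith)

theorem joinedByCurve_up (s : ℝ) (p : HypSpace K n) :
    JoinedByCurve univ |s| p (up s p) := by
  have hj := joinedByCurve_of_lipschitz (γ := fun t => up (t * s) p) (M := |s|) (S := univ)
    (abs_nonneg s) (fun _ _ => mem_univ _) (fun r _ t _ => by
      rw [dist_up_up, ← sub_mul, abs_mul, mul_comm])
  simpa [up_zero] using hj

/-- Move vertically to the height of `q`, at cost at most `dist p q`, then along the horosphere; the
remaining distance is at most `2 * dist p q`. Any bound in terms of the distance suffices, so
geodesics are not needed. -/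
theorem joinedByCurve_univ (p q : HypSpace K n) :
    JoinedByCurve univ (dist p q + Real.sinh (2 * dist p q)) p q := by
  set s := busemannInfty p - busemannInfty q with hs
  have hsd : |s| ≤ dist p q := by
    rw [abs_le]
    constructor
    · linarith [busemannInfty_le q p, dist_comm p q]
    · linarith [busemannInfty_le p q]
  have hheight : (up s p).height = q.height :=
    height_eq_of_busemannInfty_eq (by rw [busemannInfty_up, hs]; ring)
  have hdist : dist (up s p) q ≤ 2 * dist p q := by
    have := dist_triangle_left (up s p) q p
    rw [dist_up] at this
    linarith
  exact ((joinedByCurve_up s p).mono Subset.rfl hsd).trans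
    ((joinedByCurve_horosphere hheight).mono (subset_univ _) (Real.sinh_le_sinh.2 hdist))

/-- Horoballs about `∞`, and their images under isometries. -/
theorem isDetourable_preimage (g : HypSpace K n ≃ᵢ HypSpace K n) (t : ℝ) :
    IsDetourable {p | busemannInfty (g p) < t} := by
  refine ⟨fun p => busemannInfty (g p), t, rfl, fun p q => ?_, fun p s hs => ?_,
    fun p q hp hq => ?_⟩
  · rw [← g.isometry.dist_eq]
    exact busemannInfty_le _ _
  · refine ⟨g.symm (up s (g p)), ?_, ?_⟩
    · rw [← g.isometry.dist_eq, g.apply_symm_apply, dist_up, abs_of_nonneg hs]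
    · change busemannInfty (g (g.symm _)) = _
      rw [g.apply_symm_apply, busemannInfty_up]
  · have hh : (g p).height = (g q).height := height_eq_of_busemannInfty_eq (hp.trans hq.symm)
    have := (joinedByCurve_horosphere hh).map g.symm one_pos
      (T := {z | busemannInfty (g z) = t})
      (fun x y => by rw [g.symm.isometry.dist_eq, one_mul]) (fun z hz => by
        have hz : z.height = (g p).height := hz
        change busemannInfty (g (g.symm z)) = t
        rw [g.apply_symm_apply, ← show busemannInfty (g p) = t from hp, busemannInfty,
          busemannInfty, hz])
    rwa [g.symm_apply_apply, g.symm_apply_apply, one_mul, g.isometry.dist_eq] at this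

end HypSpace

end RankOne
namespace RankOne

open HurwitzAlgebra

/-! ### Continuity of the algebra operations. -/

namespace HurwitzAlgebra

variable {K : Type} [NormedAddCommGroup K] [InnerProductSpace ℝ K] [HurwitzAlgebra K]

theorem continuous_mul : Continuous fun p : K × K => mul p.1 p.2 :=
  (LinearMap.mkContinuous₂ (mul (K := K)) 1 fun a b => by rw [norm_mul', one_mul]).continuous₂

theorem continuous_re : Continuous (re : K → ℝ) := by
  unfold re
  fun_prop

theorem continuous_conj : Continuous (conj : K → K) := by
  have : (conj : K → K) = fun a => (2 * re a) • one - a := funext conj_eq'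
  have h := continuous_re (K := K)
  rw [this]
  fun_prop

theorem continuous_sesq {m : ℕ} :
    Continuous fun p : PiLp 2 (fun _ : Fin m => K) × PiLp 2 (fun _ : Fin m => K) =>
      sesq p.1 p.2 := by
  refine continuous_finsetSum _ fun i _ => continuous_mul.comp (Continuous.prodMk ?_ ?_)
  · exact continuous_conj.comp (by fun_prop)
  · fun_prop

end HurwitzAlgebra

namespace HypSpace

variable {K : Type} [NormedAddCommGroup K] [InnerProductSpace ℝ K] [HurwitzAlgebra K] {n : ℕ}

/-! ### The topology of the hyperbolic spaces -/

/-- The coordinates of a point as a vector. -/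
def coord (p : HypSpace K n) : PiLp 2 (fun _ : Fin (n - 1) => K) × K := (p.vec, p.last)

/-- The Hermitian product in coordinates, also at boundary points. -/
def hermCoord (v w : PiLp 2 (fun _ : Fin (n - 1) => K) × K) : K :=
  conj v.2 + w.2 - (2 : ℝ) • sesq v.1 w.1

/-- The height in coordinates, also at boundary points. -/
noncomputable def heightCoord (v : PiLp 2 (fun _ : Fin (n - 1) => K) × K) : ℝ := re v.2 - ‖v.1‖ ^ 2

theorem continuous_hermCoord (v : PiLp 2 (fun _ : Fin (n - 1) => K) × K) :
    Continuous (hermCoord v) := by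
  have h : Continuous fun w : PiLp 2 (fun _ : Fin (n - 1) => K) × K => sesq v.1 w.1 :=
    continuous_sesq.comp (continuous_const.prodMk continuous_fst)
  unfold hermCoord
  fun_prop

theorem continuous_heightCoord : Continuous (heightCoord (K := K) (n := n)) := by
  have h := continuous_re (K := K)
  unfold heightCoord
  fun_prop

theorem norm_hermCoord_comm (v w : PiLp 2 (fun _ : Fin (n - 1) => K) × K) :
    ‖hermCoord v w‖ = ‖hermCoord w v‖ := by
  rw [← norm_conj (hermCoord v w)]
  congr 1
  simp only [hermCoord, map_sub, map_add, map_smul, conj_sesq, conj_conj]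
  abel

theorem re_hermCoord (v w : PiLp 2 (fun _ : Fin (n - 1) => K) × K) :
    re (hermCoord v w) = heightCoord v + heightCoord w + ‖v.1 - w.1‖ ^ 2 := by
  rw [hermCoord, re_sub, re_add, re_conj, re_smul, re_sesq, norm_sub_sq_real, heightCoord,
    heightCoord]
  ring

theorem norm_hermCoord_pos (p : HypSpace K n) {w : PiLp 2 (fun _ : Fin (n - 1) => K) × K}
    (hw : 0 ≤ heightCoord w) : 0 < ‖hermCoord p.coord w‖ := by
  refine lt_of_lt_of_le ?_ (re_le_norm _)
  rw [re_hermCoord]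
  have := p.height_pos
  change 0 < p.height + _ + _
  positivity

/-- The point with given coordinates. -/
def ofCoord (v : {v : PiLp 2 (fun _ : Fin (n - 1) => K) × K // 0 < heightCoord v}) :
    HypSpace K n where
  vec := v.1.1
  last := v.1.2
  norm_sq_lt := sub_pos.1 v.2

/-- The hyperbolic metric is continuous in the coordinates, so compactness of coordinate sets passes
to `HypSpace`. -/
theorem continuous_ofCoord : Continuous (ofCoord (K := K) (n := n)) := by
  refine continuous_iff_continuousAt.2 fun v => tendsto_iff_dist_tendsto_zero.2 ?_
  have hc : Continuous fun w => coshDist (ofCoord v) (ofCoord (K := K) (n := n) w) := by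
    have h1 : Continuous fun w : {v : PiLp 2 (fun _ : Fin (n - 1) => K) × K // 0 < heightCoord v} =>
        ‖hermCoord v.1 w.1‖ := ((continuous_hermCoord v.1).comp continuous_subtype_val).norm
    have h2 : Continuous fun w : {v : PiLp 2 (fun _ : Fin (n - 1) => K) × K // 0 < heightCoord v} =>
        2 * √(heightCoord v.1 * heightCoord w.1) := by
      have := continuous_heightCoord (K := K) (n := n)
      fun_prop
    exact h1.div h2 fun w => by
      have := mul_pos v.2 w.2
      positivity
  have hd : Continuous fun w => dist (ofCoord v) (ofCoord (K := K) (n := n) w) :=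
    Real.continuousOn_arcosh.comp_continuous hc fun w => one_le_coshDist _ _
  have := hd.tendsto v
  simp only [dist_self] at this
  simpa only [dist_comm] using this

theorem height_base : (base : HypSpace K n).height = 1 := by
  simp [height, base, re_one]

theorem herm_base (p : HypSpace K n) : herm base p = one + p.last := by
  simp [herm, base, conj_one, sesq]

theorem totallyBounded_closedBall [FiniteDimensional ℝ K] (R : ℝ) :
    TotallyBounded (Metric.closedBall (base : HypSpace K n) R) := by
  -- For `p` in the ball with height `h`, `1 + h ≤ ‖herm base p‖ ≤ 2 k √h`. Hence `(2 k)⁻¹ ≤ √h ≤ 2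
  -- k`, and `‖p.last‖ ≤ 4 k ^ 2 + 1`; this explains `c` and `C`.
  set k := Real.cosh R with hk
  have hk1 : 1 ≤ k := Real.one_le_cosh R
  set C := 4 * k ^ 2 + 1 with hC
  have hC1 : 1 ≤ C := by rw [hC]; nlinarith
  set c := ((2 * k)⁻¹) ^ 2 with hc
  have hc0 : 0 < c := by positivity
  let Q : Set (PiLp 2 (fun _ : Fin (n - 1) => K) × K) :=
    Metric.closedBall 0 C ∩ {v | c ≤ heightCoord v}
  have : ProperSpace (PiLp 2 (fun _ : Fin (n - 1) => K) × K) := FiniteDimensional.proper_real _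
  have hQ : IsCompact Q := (isCompact_closedBall _ _).inter_right
    (isClosed_le continuous_const continuous_heightCoord)
  have : CompactSpace Q := isCompact_iff_compactSpace.1 hQ
  let f : Q → HypSpace K n := fun v => ofCoord ⟨v.1, hc0.trans_le v.2.2⟩
  have hf : Continuous f := continuous_ofCoord.comp (continuous_subtype_val.subtype_mk _)
  refine (isCompact_range hf).totallyBounded.subset fun p hp => ?_
  rw [Metric.mem_closedBall, dist_comm] at hp
  have hp0 := p.height_pos
  have hsq := Real.sq_sqrt hp0.le
  have hs := Real.sqrt_pos.2 hp0
  have hcosh : ‖herm base p‖ ≤ 2 * √p.height * k := by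
    have h1 : Real.cosh (dist base p) ≤ k := by
      rw [hk, Real.cosh_le_cosh, abs_of_nonneg (dist_nonneg : 0 ≤ dist base p)]
      exact hp.trans (le_abs_self R)
    rw [cosh_dist, height_base, one_mul, div_le_iff₀ (by positivity)] at h1
    linarith
  have hre := re_le_norm (herm base p)
  have hvec : (0 : ℝ) ≤ ‖(base : HypSpace K n).vec - p.vec‖ ^ 2 := sq_nonneg _
  rw [re_herm, height_base] at hre
  have hsu : √p.height ≤ 2 * k := by
    refine le_of_mul_le_mul_right ?_ hs
    nlinarith
  have hlast : ‖p.last‖ ≤ C := by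
    have h1 : p.last = herm base p - one := by rw [herm_base]; abel
    have h2 := norm_sub_le (herm base p) one
    rw [← h1, HurwitzAlgebra.norm_one'] at h2
    nlinarith
  have hvecC : ‖p.vec‖ ≤ C := by
    refine (sq_le_sq₀ (norm_nonneg _) (by positivity)).1 ?_
    nlinarith [p.norm_sq_lt, re_le_norm p.last]
  have hheight : c ≤ p.height := by
    rw [← hsq, hc]
    refine pow_le_pow_left₀ (by positivity) ?_ 2
    rw [inv_le_iff_one_le_mul₀ (by positivity)]
    nlinarith
  exact ⟨⟨p.coord, by simpa [coord] using ⟨hvecC, hlast⟩, hheight⟩, rfl⟩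

/-! ### Busemann functions -/

theorem tendsto_cosh_div_cosh {a b : ℕ → ℝ} {l : ℝ} (ha : Tendsto a atTop atTop)
    (hb : Tendsto b atTop atTop) (h : Tendsto (fun k => a k - b k) atTop (𝓝 l)) :
    Tendsto (fun k => Real.cosh (a k) / Real.cosh (b k)) atTop (𝓝 (Real.exp l)) := by
  have key {c : ℕ → ℝ} (hc : Tendsto c atTop atTop) :
      Tendsto (fun k => 1 + Real.exp (-(2 * c k))) atTop (𝓝 (1 + 0)) :=
    tendsto_const_nhds.add (Real.tendsto_exp_neg_atTop_nhds_zero.comp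
      (hc.const_mul_atTop two_pos))
  have h1 := ((Real.continuous_exp.tendsto l).comp h).mul ((key ha).div (key hb) (by norm_num))
  simp only [add_zero, div_one, mul_one] at h1
  refine h1.congr fun k => ?_
  have e (x : ℝ) : Real.cosh x = Real.exp x * (1 + Real.exp (-(2 * x))) / 2 := by
    rw [Real.cosh_eq, mul_add, ← Real.exp_add]
    ring_nf
  simp only [Pi.div_apply, Function.comp]
  rw [e, e, Real.exp_sub]
  have : 0 < 1 + Real.exp (-(2 * b k)) := by positivity
  field_simp

/-- Since `cosh` is asymptotic to `exp / 2`, differences of distances become quotients of `cosh`, in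
which the height of `u k` cancels. The remaining quotient of forms makes sense at boundary points
too. -/
theorem tendsto_norm_herm_div {u : ℕ → HypSpace K n} {y : HypSpace K n} {l : ℝ}
    (hd : Tendsto (fun k => dist base (u k)) atTop atTop)
    (h : Tendsto (fun k => dist y (u k) - dist base (u k)) atTop (𝓝 l)) :
    Tendsto (fun k => ‖herm y (u k)‖ / ‖herm base (u k)‖) atTop
      (𝓝 (Real.exp l * √y.height)) := by
  have hd' : Tendsto (fun k => dist y (u k)) atTop atTop :=
    tendsto_atTop_mono (fun k => by
      linarith [dist_triangle base y (u k)] : ∀ k, dist base (u k) - dist base y ≤ dist y (u k))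
      (tendsto_atTop_add_const_right _ _ hd)
  refine ((tendsto_cosh_div_cosh hd' hd h).mul_const (√y.height)).congr fun k => ?_
  have hy := Real.sqrt_pos.2 y.height_pos
  have hu := Real.sqrt_pos.2 (u k).height_pos
  rw [cosh_dist, cosh_dist, height_base, one_mul, Real.sqrt_mul y.height_pos.le]
  field_simp

theorem norm_vec_le (p : HypSpace K n) : ‖p.vec‖ ≤ √‖p.last‖ :=
  Real.le_sqrt_of_sq_le (p.norm_sq_lt.le.trans (re_le_norm _))

/-- By `norm_vec_le` the vector part of `u k` contributes only on the order of the square root of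
`‖(u k).last‖`. -/
theorem tendsto_norm_herm_div_norm_last {u : ℕ → HypSpace K n}
    (hu : Tendsto (fun k => ‖(u k).last‖) atTop atTop) (y : HypSpace K n) :
    Tendsto (fun k => ‖herm y (u k)‖ / ‖(u k).last‖) atTop (𝓝 1) := by
  have hbound (k : ℕ) : |‖herm y (u k)‖ / ‖(u k).last‖ - 1| ≤
      ‖y.last‖ / ‖(u k).last‖ + 2 * ‖y.vec‖ / √‖(u k).last‖ := by
    have h0 := (u k).norm_last_pos
    have h1 : |‖herm y (u k)‖ - ‖(u k).last‖| ≤ ‖y.last‖ + 2 * (‖y.vec‖ * √‖(u k).last‖) := by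
      refine (abs_norm_sub_norm_le _ _).trans ?_
      have : herm y (u k) - (u k).last = conj y.last - (2 : ℝ) • sesq y.vec (u k).vec := by
        rw [herm]; abel
      rw [this]
      refine (norm_sub_le _ _).trans ?_
      rw [norm_conj, norm_smul, Real.norm_ofNat]
      gcongr
      exact (norm_sesq_le _ _).trans
        (mul_le_mul_of_nonneg_left (norm_vec_le _) (norm_nonneg _))
    have h2 : ‖herm y (u k)‖ / ‖(u k).last‖ - 1 =
        (‖herm y (u k)‖ - ‖(u k).last‖) / ‖(u k).last‖ := by field_simp
    rw [h2, abs_div, abs_of_pos h0, div_le_iff₀ h0]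
    refine h1.trans (le_of_eq ?_)
    have hs := Real.sqrt_pos.2 h0
    have hsq := Real.sq_sqrt h0.le
    generalize √‖(u k).last‖ = r at *
    rw [← hsq]
    field_simp
  have hlim : Tendsto (fun k => ‖y.last‖ / ‖(u k).last‖ + 2 * ‖y.vec‖ / √‖(u k).last‖) atTop
      (𝓝 (0 + 0)) :=
    (hu.const_div_atTop _).add ((Real.tendsto_sqrt_atTop.comp hu).const_div_atTop _)
  rw [add_zero] at hlim
  rw [tendsto_iff_dist_tendsto_zero]
  exact squeeze_zero (fun _ => dist_nonneg) hbound hlim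

/-- The translation takes the boundary point `(v, a)` to `0` and the inversion takes `0` to `∞`. The
last coordinate of the translated point is its form with `(v, a)`. -/
theorem busemannInfty_inversion_heis (v : PiLp 2 (fun _ : Fin (n - 1) => K)) (a : K)
    (h : re a = ‖v‖ ^ 2) (y : HypSpace K n) :
    busemannInfty (inversion (heis (-v) (conj a) (by rw [re_conj, norm_neg, h]) y)) =
      Real.log ‖hermCoord y.coord (v, a)‖ - Real.log y.height / 2 := by
  have hpos : 0 < ‖hermCoord y.coord (v, a)‖ :=
    norm_hermCoord_pos y (by rw [heightCoord, h, sub_self])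
  have hl : (heis (-v) (conj a) (by rw [re_conj, norm_neg, h]) y).last =
      hermCoord (v, a) y.coord := by
    simp only [heis, hermCoord, coord, sesq_neg_left]
    module
  rw [busemannInfty, height_inversion, height_heis, hl, norm_hermCoord_comm,
    Real.log_mul (by positivity) y.height_pos.ne', Real.log_pow, Real.log_inv]
  push_cast
  ring

/-- A limit of normalized distance functions to points that go to infinity is, up to a constant,
the composition of `busemannInfty` and an isometry. -/
theorem exists_isometryEquiv_of_tendsto [FiniteDimensional ℝ K] (hK : SesqNormMul K (n - 1))
    {u : ℕ → HypSpace K n} {β : HypSpace K n → ℝ}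
    (hd : Tendsto (fun k => dist base (u k)) atTop atTop)
    (hβ : ∀ y, Tendsto (fun k => dist y (u k) - dist base (u k)) atTop (𝓝 (β y))) :
    ∃ (g : HypSpace K n ≃ᵢ HypSpace K n) (c : ℝ), ∀ y, β y = busemannInfty (g y) + c := by
  have hratio := fun y => tendsto_norm_herm_div hd (hβ y)
  -- If the last coordinates tend to infinity, the limit point is `∞`: the quotients of forms tend
  -- to `1`.
  by_cases hu : Tendsto (fun k => ‖(u k).last‖) atTop atTop
  · refine ⟨IsometryEquiv.refl _, 0, fun y => ?_⟩
    have h1 : Tendsto (fun k => ‖herm y (u k)‖ / ‖herm base (u k)‖) atTop (𝓝 (1 / 1)) := by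
      refine ((tendsto_norm_herm_div_norm_last hu y).div
        (tendsto_norm_herm_div_norm_last hu base) one_ne_zero).congr fun k => ?_
      have := (u k).norm_last_pos
      simp only [Pi.div_apply]
      field_simp
    have h2 := tendsto_nhds_unique (hratio y) h1
    have hy := y.height_pos
    have h3 := congrArg Real.log h2
    rw [Real.log_mul (Real.exp_pos _).ne' (by positivity), Real.log_exp, Real.log_sqrt hy.le,
      div_one, Real.log_one] at h3
    change β y = -(Real.log y.height) / 2 + 0
    linarith
  · obtain ⟨C, hC⟩ : ∃ C, ∃ᶠ k in atTop, ‖(u k).last‖ < C := by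
      rw [tendsto_atTop] at hu
      push Not at hu
      obtain ⟨C, hC⟩ := hu
      exact ⟨C, hC.mono fun k hk => by simpa using hk⟩
    have : ProperSpace (PiLp 2 (fun _ : Fin (n - 1) => K) × K) := FiniteDimensional.proper_real _
    obtain ⟨⟨v, a⟩, -, φ, hφ, hlim⟩ := tendsto_subseq_of_frequently_bounded
      (x := fun k => (u k).coord)
      (Metric.isBounded_closedBall (x := (0 : PiLp 2 (fun _ : Fin (n - 1) => K) × K))
        (r := max C √C)) (hC.mono fun k hk => by
          simp only [mem_closedBall_zero_iff, coord, Prod.norm_mk]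
          exact max_le ((norm_vec_le _).trans ((Real.sqrt_le_sqrt hk.le).trans (le_max_right _ _)))
            (hk.le.trans (le_max_left _ _)))
    have hherm (y : HypSpace K n) : Tendsto (fun k => ‖herm y (u (φ k))‖) atTop
        (𝓝 ‖hermCoord y.coord (v, a)‖) :=
      (((continuous_hermCoord y.coord).norm.tendsto _).comp hlim)
    have hheight : Tendsto (fun k => (u (φ k)).height) atTop (𝓝 (heightCoord (v, a))) :=
      (continuous_heightCoord.tendsto _).comp hlim
    have hva0 : 0 ≤ heightCoord (v, a) :=
      ge_of_tendsto' hheight fun k => (u (φ k)).height_pos.le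
    -- The limit is a boundary point: at positive height the distances to `base` would stay bounded
    -- along the subsequence.
    have hva : heightCoord (v, a) = 0 := by
      by_contra hne
      have hpos : 0 < heightCoord (v, a) := lt_of_le_of_ne hva0 (Ne.symm hne)
      have h1 : Tendsto (fun k => Real.cosh (dist base (u (φ k)))) atTop
          (𝓝 (‖hermCoord (base : HypSpace K n).coord (v, a)‖ / (2 * √(heightCoord (v, a))))) := by
        refine ((hherm base).div ((hheight.sqrt).const_mul 2) (by positivity)).congr fun k => ?_
        rw [cosh_dist, height_base, one_mul]
        rfl
      refine not_tendsto_nhds_of_tendsto_atTop (tendsto_atTop_mono (fun k => ?_)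
        (hd.comp hφ.tendsto_atTop)) _ h1
      exact (Real.self_le_sinh_iff.2 dist_nonneg).trans (Real.sinh_lt_cosh _).le
    have hre : re a = ‖v‖ ^ 2 := sub_eq_zero.1 hva
    refine ⟨(heisEquiv (-v) (conj a) (by rw [re_conj, norm_neg, hre])).trans (inversionEquiv hK),
      -Real.log ‖hermCoord (base : HypSpace K n).coord (v, a)‖, fun y => ?_⟩
    have hN0 := norm_hermCoord_pos base hva0
    have hN := norm_hermCoord_pos y hva0
    have h2 := tendsto_nhds_unique ((hratio y).comp hφ.tendsto_atTop)
      ((hherm y).div (hherm base) hN0.ne')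
    have hy := y.height_pos
    have h3 := congrArg Real.log h2
    rw [Real.log_mul (Real.exp_pos _).ne' (by positivity), Real.log_exp, Real.log_sqrt hy.le,
      Real.log_div hN.ne' hN0.ne'] at h3
    have h4 := busemannInfty_inversion_heis v a hre y
    change β y = busemannInfty (inversion (heis (-v) (conj a)
      (by rw [re_conj, norm_neg, hre]) y)) + _
    rw [h4]
    linarith

/-! ### Truncated spaces -/

variable {X : Type*} [MetricSpace X]

/-- The ray, sampled at integer times, is carried to the model by `e`. Differences of Busemann
values are multiplied by the ratio `r`, and subtracting `b o` normalizes at `base`, so the threshold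
`t` becomes `r * (t - b o) - c`. -/
theorem isDetourable_image [FiniteDimensional ℝ K] (hK : SesqNormMul K (n - 1))
    (e : X ≃ᵈ HypSpace K n) {B : Set X} (hB : IsOpenHoroball B) : IsDetourable (e '' B) := by
  obtain ⟨b, t, ⟨γ, -, hγ⟩, rfl⟩ := hB
  set r : ℝ := (Dilation.ratio e : ℝ) with hr
  have hr0 : 0 < r := NNReal.coe_pos.2 (Dilation.ratio_pos e)
  have hdist (x y : X) : dist (e x) (e y) = r * dist x y := Dilation.dist_eq e x y
  have hcast : Tendsto (fun k : ℕ => (k : ℝ≥0)) atTop atTop := tendsto_natCast_atTop_atTop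
  have hγ' (x : X) := (hγ x).comp hcast
  set o : X := e.symm base with ho
  have heo : e o = base := e.apply_symm_apply _
  have hinf (x : X) : Tendsto (fun k : ℕ => dist x (γ k)) atTop atTop := by
    have h := (hγ' x).add_atTop (tendsto_natCast_atTop_atTop (R := ℝ))
    refine h.congr fun k => ?_
    simp
  obtain ⟨g, c, hg⟩ := exists_isometryEquiv_of_tendsto hK (u := fun k : ℕ => e (γ k))
    (β := fun y => r * (b (e.symm y) - b o))
    (by
      refine ((hinf o).const_mul_atTop hr0).congr fun k => ?_
      rw [← hdist, heo])
    (fun y => by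
      refine (((hγ' (e.symm y)).sub (hγ' o)).const_mul r).congr fun k => ?_
      have h1 := hdist (e.symm y) (γ k)
      have h2 := hdist o (γ k)
      rw [e.apply_symm_apply] at h1
      rw [heo] at h2
      rw [h1, h2]
      simp only [Function.comp]
      ring)
  have : e '' {x | b x < t} = {y | busemannInfty (g y) < r * (t - b o) - c} := by
    ext y
    have h1 := hg y
    have h2 : y ∈ e '' {x | b x < t} ↔ b (e.symm y) < t := by
      constructor
      · rintro ⟨x, hx, rfl⟩
        rwa [e.symm_apply_apply]
      · exact fun h => ⟨e.symm y, h, e.apply_symm_apply y⟩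
    rw [h2]
    change _ ↔ busemannInfty (g y) < _
    rw [lt_sub_iff_add_lt, ← h1, mul_lt_mul_iff_right₀ hr0, sub_lt_sub_iff_right]
  rw [this]
  exact isDetourable_preimage g _

theorem add_sinh_two_mul_mono : Monotone fun d : ℝ => d + Real.sinh (2 * d) := fun a b h =>
  add_le_add h (Real.sinh_le_sinh.2 (by linarith))

/-- Nearby points of a truncated space are joined in it by uniformly short curves. -/
theorem exists_joinedByCurve_truncatedSpace [FiniteDimensional ℝ K] (hK : SesqNormMul K (n - 1))
    (e : X ≃ᵈ HypSpace K n) {Ω : Set X} (hΩ : IsTruncatedSpace Ω) (R : ℝ) :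
    ∃ M : ℝ, ∀ x y, x ∈ Ω → y ∈ Ω → dist x y ≤ R → JoinedByCurve Ω M x y := by
  obtain ⟨𝓑, h𝓑, hdisj, rfl⟩ := hΩ
  set r : ℝ := (Dilation.ratio e : ℝ) with hr
  have hr0 : 0 < r := NNReal.coe_pos.2 (Dilation.ratio_pos e)
  have hdist (x y : X) : dist (e x) (e y) = r * dist x y := Dilation.dist_eq e x y
  have hdet : ∀ B ∈ image e '' 𝓑, IsDetourable B := by
    rintro _ ⟨B, hB, rfl⟩
    exact isDetourable_image hK e (h𝓑 B hB)
  have hdisj' : (image e '' 𝓑).PairwiseDisjoint id := by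
    rintro _ ⟨B, hB, rfl⟩ _ ⟨C, hC, rfl⟩ hne
    exact (disjoint_image_iff e.injective).2 (hdisj hB hC fun h => hne (by rw [h]))
  have hmem (x : X) : e x ∈ (⋃₀ (image e '' 𝓑))ᶜ ↔ x ∈ (⋃₀ 𝓑)ᶜ := by
    rw [mem_compl_iff, mem_compl_iff, not_iff_not]
    constructor
    · rintro ⟨_, ⟨B, hB, rfl⟩, hx⟩
      exact ⟨B, hB, (e.injective.mem_set_image).1 hx⟩
    · rintro ⟨B, hB, hx⟩
      exact ⟨_, ⟨B, hB, rfl⟩, mem_image_of_mem e hx⟩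
  obtain ⟨M, hM⟩ := exists_joinedByCurve_compl exists_isometry_eq_base totallyBounded_closedBall
    add_sinh_two_mul_mono joinedByCurve_univ hdet hdisj' (r * R)
  refine ⟨r⁻¹ * M, fun x y hx hy hxy => ?_⟩
  have hj := hM (e x) (e y) ((hmem x).2 hx) ((hmem y).2 hy) (by
    rw [hdist]
    exact mul_le_mul_of_nonneg_left hxy hr0.le)
  have := hj.map e.symm (inv_pos.2 hr0) (T := (⋃₀ 𝓑)ᶜ)
    (fun p q => by
      have := hdist (e.symm p) (e.symm q)
      rw [e.apply_symm_apply, e.apply_symm_apply] at this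
      rw [this]
      field_simp)
    (fun p hp => by
      rw [← hmem, e.apply_symm_apply]
      exact hp)
  rwa [e.symm_apply_apply, e.symm_apply_apply] at this

end HypSpace

end RankOne

theorem mainTheorem3 {X : Type*} [MetricSpace X] [MeasurableSpace X] [BorelSpace X]
    (hX : RankOne.IsRankOneSymmetricSpace X) (Ω : Set X)
    (hΩ : RankOne.IsEquivariantTruncatedSpace Ω) :
    (∀ x y : Ω, RankOne.pathEDist x y ≠ ∞) ∧
      RankOne.IsCoarseEmbedding (fun x y : Ω => (RankOne.pathEDist x y).toNNReal)
        (fun x y : X => nndist x y) (Subtype.val : Ω → X) := by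
  refine RankOne.isCoarseEmbedding_of_joinedByCurve ?_
  rcases hX with ⟨n, -, ⟨e⟩⟩ | ⟨n, -, ⟨e⟩⟩ | ⟨n, -, ⟨e⟩⟩ | he
  · exact RankOne.HypSpace.exists_joinedByCurve_truncatedSpace
      (RankOne.HurwitzAlgebra.sesqNormMul_of_assoc (fun a b c : ℝ => mul_assoc a b c) _) e hΩ.1
  · exact RankOne.HypSpace.exists_joinedByCurve_truncatedSpace
      (RankOne.HurwitzAlgebra.sesqNormMul_of_assoc (fun a b c : ℂ => mul_assoc a b c) _) e hΩ.1
  · exact RankOne.HypSpace.exists_joinedByCurve_truncatedSpace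
      (RankOne.HurwitzAlgebra.sesqNormMul_of_assoc (fun a b c : ℍ[ℝ] => mul_assoc a b c) _) e hΩ.1
  -- The octonionic plane has `2 - 1 = 1` vector coordinate, so norm multiplicativity replaces
  -- associativity.
  · obtain ⟨e⟩ := he
    exact RankOne.HypSpace.exists_joinedByCurve_truncatedSpace
      (RankOne.HurwitzAlgebra.sesqNormMul_of_le_one (m := 2 - 1) (by norm_num)) e hΩ.1
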